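/- Let $n\ge 3$ be an odd integer, $\Bbbk$ an algebraically closed field of characteristic $0$, and $q\in\Bbbk$ a primitive $n$th root of unity. Let $\mathsf D_n$ (the Drinfeld double of the Taft algebra) be the Hopf algebra over $\Bbbk$ generated by $a,b,c,d$ with relations $$ba=qab,\quad db=qbd,\quad ca=qac,\quad dc=qcd,\quad bc=cb,\quad da-q\,ad=1-bc,\quad a^n=d^n=0,\quad b^n=c^n=1,$$ coproduct $\Delta(a)=a\otimes b+1\otimes a$, $\Delta(d)=d\otimes c+1\otimes d$, $\Delta(b)=b\otimes b$, $\Delta(c)=c\otimes c$, and counit $\varepsilon(a)=\varepsilon(d)=0$, $\varepsilon(b)=\varepsilon(c)=1$. Its simple modules are the $\mathsf V(\ell,r)$, $1\le \ell\le n$, $r\in\mathbb Z/n\mathbb Z$, where $\mathsf V(\ell,r)$ has basis $v_1,\dots,v_\ell$ and action $$a.v_j=v_{j+1}\ (j<\ell),\quad a.v_\ell=0,\quad b.v_j=q^{r+j-1}v_j,\quad c.v_j=q^{j-(r+\ell)}v_j,\quad d.v_j=\tfrac{(q^{j-1}-1)(1-q^{j-1-\ell})}{q-1}\,v_{j-1}\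 (j>1),\quad d.v_1=0.$$ Let $\mathsf M=\mathsf M_{\mathsf V}$ be the McKay matrix of $\mathsf V=\mathsf V(2,0)$: the $n^2\times n^2$ matrix, indexed by the pairs $(\ell,r)$, whose entry at $\big((\ell,r),(\ell',r')\big)$ is the composition multiplicity $[\mathsf V(\ell,r)\otimes\mathsf V:\mathsf V(\ell',r')]$. For $x\in\mathsf D_n$ let $\operatorname{Tr}_{\mathsf S}(x)\in\Bbbk^{n^2}$ be the column vector of the traces of $x$ on the modules $\mathsf V(\ell,r)$. Write $[m]=1+q+\dots+q^{m-1}$. Let $0\le i,k\le n-1$ with $k\not\equiv -i \pmod n$, and let $1\le s\le n-1$ with $s\equiv-(i+k)\pmod n$. Define $\gamma_1,\dots,\gamma_s\in\Bbbk$ recursively by $\gamma_s=1$ and $$\gamma_\ell=\frac{[\ell+1]^2\,q^{-1-\ell+s}}{[\ell]\,[s-\ell]\,(q-1)}\;\gamma_{\ell+1}\qquad(\ell=s-1,s-2,\dots,1),$$ and set $w=\sum_{\ell=1}^s\gamma_\ell\operatorname{Tr}_{\mathsf S}(b^ic^kd^\ell a^\ell)$. Then $\operatorname{Tr}_{\mathsf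 S}(b^ic^k)$ is an eigenvector of $\mathsf M$ for some eigenvalue $\mu$, and $w$ lies in the generalized eigenspace of $\mathsf M$ for the same $\mu$. Moreover, $w$ is a generalized eigenvector in the strict sense that $(\mathsf M-\mu)w$ is a (nonzero) eigenvector of $\mathsf M$ for $\mu$, and $w$ is the trace vector $\operatorname{Tr}_{\mathsf S}(x)$ of the element $x=\sum_{\ell=1}^s\gamma_\ell\, b^ic^kd^\ell a^\ell$, which is not grouplike. -/

import Mathlib

open scoped TensorProduct

namespace TaftDouble

/-! ### Generalities: composition multiplicities, representations, McKay matrices -/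

section General

/-- The number of factors of a composition series of submodules of `U` that are isomorphic
to `S`. -/
noncomputable def factorCount {A U : Type*} [Ring A] [AddCommGroup U] [Module A U]
    (S : Type*) [AddCommGroup S] [Module A S] (c : CompositionSeries (Submodule A U)) : ℕ :=
  Nat.card {i : Fin c.length //
    Nonempty ((c i.succ ⧸ (c i.castSucc).comap (c i.succ).subtype) ≃ₗ[A] S)}

open Classical in
/-- The composition multiplicity `[U : S]`: the number of factors isomorphic to `S` in a
composition series `0 = U₀ < U₁ < ⋯ < U_m = U`. It does not depend on the series, see
`compMult_eq`. (The value is `0` if `U` has no composition series.) -/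
noncomputable def compMult (A U S : Type*) [Ring A] [AddCommGroup U] [Module A U]
    [AddCommGroup S] [Module A S] : ℕ :=
  if h : ∃ c : CompositionSeries (Submodule A U), c.head = ⊥ ∧ c.last = ⊤ then
    factorCount S h.choose
  else 0

theorem compMult_eq {A U S : Type*} [Ring A] [AddCommGroup U] [Module A U]
    [AddCommGroup S] [Module A S] (c : CompositionSeries (Submodule A U))
    (h₀ : c.head = ⊥) (h₁ : c.last = ⊤) : compMult A U S = factorCount S c := by
  have h : ∃ c : CompositionSeries (Submodule A U), c.head = ⊥ ∧ c.last = ⊤ := ⟨c, h₀, h₁⟩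
  rw [compMult, dif_pos h]
  obtain ⟨e, he⟩ := CompositionSeries.jordan_holder h.choose c
    (h.choose_spec.1.trans h₀.symm) (h.choose_spec.2.trans h₁.symm)
  refine Nat.card_congr (e.subtypeEquiv fun i => ?_)
  have f := (he i).linearEquiv
  exact ⟨fun ⟨g⟩ => ⟨f.symm.trans g⟩, fun ⟨g⟩ => ⟨f.trans g⟩⟩

/-- The vector space `V`, seen as a left `A`-module through a representation
`ρ : A → End V`. -/
def RepModule {𝕜 A V : Type*} [Field 𝕜] [Ring A] [Algebra 𝕜 A] [AddCommGroup V] [Module 𝕜 V]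
    (_ρ : A →ₐ[𝕜] Module.End 𝕜 V) : Type _ := V

instance {𝕜 A V : Type*} [Field 𝕜] [Ring A] [Algebra 𝕜 A] [AddCommGroup V] [Module 𝕜 V]
    (ρ : A →ₐ[𝕜] Module.End 𝕜 V) : AddCommGroup (RepModule ρ) :=
  inferInstanceAs (AddCommGroup V)

instance {𝕜 A V : Type*} [Field 𝕜] [Ring A] [Algebra 𝕜 A] [AddCommGroup V] [Module 𝕜 V]
    (ρ : A →ₐ[𝕜] Module.End 𝕜 V) : Module A (RepModule ρ) :=
  Module.compHom V ρ.toRingHom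

/-- The tensor product of two representations of a bialgebra: `x` acts on `V ⊗ W` through its
coproduct, by `∑ x₍₁₎ ⊗ x₍₂₎`. -/
noncomputable def tensorRep {𝕜 A V W : Type*} [Field 𝕜] [Ring A] [Bialgebra 𝕜 A]
    [AddCommGroup V] [Module 𝕜 V] [AddCommGroup W] [Module 𝕜 W]
    (ρ : A →ₐ[𝕜] Module.End 𝕜 V) (σ : A →ₐ[𝕜] Module.End 𝕜 W) :
    A →ₐ[𝕜] Module.End 𝕜 (V ⊗[𝕜] W) :=
  (Module.endTensorEndAlgHom (R := 𝕜) (S := 𝕜) (A := 𝕜) (M := V) (N := W)).comp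
    ((Algebra.TensorProduct.map ρ σ).comp (Bialgebra.comulAlgHom 𝕜 A))

/-- The McKay matrix of `σ` with respect to a family `S` of simple modules: its `(i, j)` entry
is the composition multiplicity `[S i ⊗ W : S j]` (as an element of the ground field). -/
noncomputable def mcKay {𝕜 A W I : Type*} [Field 𝕜] [Ring A] [Bialgebra 𝕜 A]
    [AddCommGroup W] [Module 𝕜 W] {X : I → Type*} [∀ i, AddCommGroup (X i)]
    [∀ i, Module 𝕜 (X i)] (S : ∀ i, A →ₐ[𝕜] Module.End 𝕜 (X i))
    (σ : A →ₐ[𝕜] Module.End 𝕜 W) : Matrix I I 𝕜 :=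
  Matrix.of fun i j => (compMult A (RepModule (tensorRep (S i) σ)) (RepModule (S j)) : 𝕜)

/-- The trace vector of `x`: the vector of the traces of `x` on the modules of the family. -/
noncomputable def traceVec {𝕜 A I : Type*} [Field 𝕜] [Ring A] [Algebra 𝕜 A]
    {X : I → Type*} [∀ i, AddCommGroup (X i)] [∀ i, Module 𝕜 (X i)]
    (S : ∀ i, A →ₐ[𝕜] Module.End 𝕜 (X i)) (x : A) : I → 𝕜 :=
  fun i => LinearMap.trace 𝕜 (X i) (S i x)

end General

/-! ### The `q`-binomial theorem at a root of unity (needed for the coproduct) -/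

section QBinomial

variable {𝕜 : Type*} [Field 𝕜]

/-- Gaussian binomial coefficients, by the `q`-Pascal rule. -/
def gauss (q : 𝕜) : ℕ → ℕ → 𝕜
  | _, 0 => 1
  | 0, _ + 1 => 0
  | m + 1, i + 1 => gauss q m i + q ^ (i + 1) * gauss q m (i + 1)

theorem gauss_zero_right (q : 𝕜) (m : ℕ) : gauss q m 0 = 1 := by cases m <;> rfl

theorem gauss_of_lt (q : 𝕜) : ∀ m i : ℕ, m < i → gauss q m i = 0
  | _, 0, h => by omega
  | 0, _ + 1, _ => rfl
  | m + 1, i + 1, h => by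
    rw [gauss, gauss_of_lt q m i (by omega), gauss_of_lt q m (i + 1) (by omega)]; ring

theorem gauss_self (q : 𝕜) : ∀ m : ℕ, gauss q m m = 1
  | 0 => rfl
  | m + 1 => by rw [gauss, gauss_self q m, gauss_of_lt q m (m + 1) (by omega)]; ring

theorem gauss_rel (q : 𝕜) : ∀ m i p : ℕ, m = i + p →
    (1 - q ^ (i + 1)) * gauss q m (i + 1) = (1 - q ^ p) * gauss q m i := by
  intro m
  induction m with
  | zero =>
    intro i p h
    obtain ⟨rfl, rfl⟩ : i = 0 ∧ p = 0 := by omega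
    simp [gauss]
  | succ m ih =>
    intro i p h
    rcases p with _ | p
    · rw [gauss_of_lt q (m + 1) (i + 1) (by omega)]; simp
    have h1 := ih i p (by omega)
    rcases i with _ | i
    · obtain rfl : m = p := by omega
      simp only [gauss, gauss_zero_right] at h1 ⊢
      linear_combination q * h1
    · have h2 := ih i (p + 1) (by omega)
      simp only [gauss] at h1 h2 ⊢
      linear_combination q ^ (i + 1 + 1) * h1 + h2

theorem gauss_eq_zero {q : 𝕜} {n : ℕ} (hq : IsPrimitiveRoot q n) :
    ∀ i : ℕ, 0 < i → i < n → gauss q n i = 0 := by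
  have key : ∀ i : ℕ, i + 1 < n → gauss q n (i + 1) = 0 := by
    intro i
    induction i with
    | zero =>
      intro h
      have h1 := gauss_rel q n 0 n (by omega)
      rw [hq.pow_eq_one, sub_self, zero_mul] at h1
      exact (mul_eq_zero.1 h1).resolve_left
        (sub_ne_zero.2 (hq.pow_ne_one_of_pos_of_lt (by omega) h).symm)
    | succ i ih =>
      intro h
      have h1 := gauss_rel q n (i + 1) (n - (i + 1)) (by omega)
      rw [ih (by omega), mul_zero] at h1
      exact (mul_eq_zero.1 h1).resolve_left
        (sub_ne_zero.2 (hq.pow_ne_one_of_pos_of_lt (by omega) h).symm)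
  intro i h0 h
  obtain ⟨j, rfl⟩ : ∃ j, i = j + 1 := ⟨i - 1, by omega⟩
  exact key j h

variable {B : Type*} [Ring B] [Algebra 𝕜 B]

theorem mul_pow_of_qcomm {q : 𝕜} {x y : B} (h : y * x = q • (x * y)) (i : ℕ) :
    y * x ^ i = q ^ i • (x ^ i * y) := by
  induction i with
  | zero => simp
  | succ i ih =>
    rw [pow_succ x, ← mul_assoc, ih, smul_mul_assoc, mul_assoc, h, mul_smul_comm, smul_smul,
      mul_assoc, pow_succ]

theorem add_pow_gauss {q : 𝕜} {x y : B} (h : y * x = q • (x * y)) (m : ℕ) :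
    (x + y) ^ m = ∑ i ∈ Finset.range (m + 1), gauss q m i • (x ^ i * y ^ (m - i)) := by
  induction m with
  | zero => simp [gauss]
  | succ m ih =>
    have e1 : x * (∑ i ∈ Finset.range (m + 1), gauss q m i • (x ^ i * y ^ (m - i))) =
        ∑ i ∈ Finset.range (m + 1), gauss q m i • (x ^ (i + 1) * y ^ (m + 1 - (i + 1))) := by
      rw [Finset.mul_sum]
      refine Finset.sum_congr rfl fun i _ => ?_
      rw [mul_smul_comm, ← mul_assoc, ← pow_succ', Nat.add_sub_add_right]
    have e2 : y * (∑ i ∈ Finset.range (m + 1), gauss q m i • (x ^ i * y ^ (m - i))) =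
        ∑ i ∈ Finset.range (m + 2), (q ^ i * gauss q m i) • (x ^ i * y ^ (m + 1 - i)) := by
      rw [Finset.sum_range_succ _ (m + 1), gauss_of_lt q m (m + 1) (by omega), mul_zero,
        zero_smul, add_zero, Finset.mul_sum]
      refine Finset.sum_congr rfl fun i hi => ?_
      have hi' : m + 1 - i = (m - i) + 1 := by have := Finset.mem_range.1 hi; omega
      rw [mul_smul_comm, ← mul_assoc, mul_pow_of_qcomm h, smul_mul_assoc, smul_smul, mul_assoc,
        ← pow_succ', hi', mul_comm]
    rw [pow_succ', ih, add_mul, e1, e2, Finset.sum_range_succ' _ (m + 1),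
      Finset.sum_range_succ' _ (m + 1), ← add_assoc, ← Finset.sum_add_distrib]
    congr 1
    · refine Finset.sum_congr rfl fun i _ => ?_
      rw [← add_smul, gauss]
    · simp [gauss_zero_right]

theorem add_pow_of_qcomm {q : 𝕜} {n : ℕ} [NeZero n] (hq : IsPrimitiveRoot q n) {x y : B}
    (h : y * x = q • (x * y)) : (x + y) ^ n = x ^ n + y ^ n := by
  obtain ⟨m, rfl⟩ : ∃ m, n = m + 1 := ⟨n - 1, by have := NeZero.pos n; omega⟩
  rw [add_pow_gauss h, Finset.sum_range_succ, Finset.sum_range_succ', Finset.sum_eq_zero]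
  · simp [gauss_self, gauss_zero_right, add_comm]
  · intro i hi
    rw [gauss_eq_zero hq (i + 1) (by omega) (by have := Finset.mem_range.1 hi; omega), zero_smul]

end QBinomial

/-! ### The Drinfeld double `D_n` of the Taft algebra -/

/-- The four generators of `D_n`. -/
inductive Gen
  | a | b | c | d

section Double

variable {𝕜 : Type*} [Field 𝕜]

open FreeAlgebra in
/-- The defining relations of `D_n`. -/
inductive Rel (n : ℕ) (q : 𝕜) : FreeAlgebra 𝕜 Gen → FreeAlgebra 𝕜 Gen → Prop
  | ba : Rel n q (ι 𝕜 Gen.b * ι 𝕜 Gen.a) (q • (ι 𝕜 Gen.a * ι 𝕜 Gen.b))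
  | db : Rel n q (ι 𝕜 Gen.d * ι 𝕜 Gen.b) (q • (ι 𝕜 Gen.b * ι 𝕜 Gen.d))
  | ca : Rel n q (ι 𝕜 Gen.c * ι 𝕜 Gen.a) (q • (ι 𝕜 Gen.a * ι 𝕜 Gen.c))
  | dc : Rel n q (ι 𝕜 Gen.d * ι 𝕜 Gen.c) (q • (ι 𝕜 Gen.c * ι 𝕜 Gen.d))
  | bc : Rel n q (ι 𝕜 Gen.b * ι 𝕜 Gen.c) (ι 𝕜 Gen.c * ι 𝕜 Gen.b)
  | da : Rel n q (ι 𝕜 Gen.d * ι 𝕜 Gen.a - q • (ι 𝕜 Gen.a * ι 𝕜 Gen.d))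
      (1 - ι 𝕜 Gen.b * ι 𝕜 Gen.c)
  | a_pow : Rel n q (ι 𝕜 Gen.a ^ n) 0
  | d_pow : Rel n q (ι 𝕜 Gen.d ^ n) 0
  | b_pow : Rel n q (ι 𝕜 Gen.b ^ n) 1
  | c_pow : Rel n q (ι 𝕜 Gen.c ^ n) 1

/-- The algebra `D_n`, presented by the generators `a, b, c, d` and the relations `Rel`. -/
def Dn (n : ℕ) (q : 𝕜) : Type _ := RingQuot (Rel n q)

noncomputable instance (n : ℕ) (q : 𝕜) : Ring (Dn n q) := inferInstanceAs (Ring (RingQuot _))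

noncomputable instance (n : ℕ) (q : 𝕜) : Algebra 𝕜 (Dn n q) :=
  inferInstanceAs (Algebra 𝕜 (RingQuot _))

namespace Dn

/-- The image of a generator in `D_n`. -/
noncomputable def gen (n : ℕ) (q : 𝕜) (g : Gen) : Dn n q :=
  RingQuot.mkAlgHom 𝕜 (Rel n q) (FreeAlgebra.ι 𝕜 g)

/-- The generator `a`. -/
noncomputable def a (n : ℕ) (q : 𝕜) : Dn n q := gen n q Gen.a
/-- The generator `b`. -/
noncomputable def b (n : ℕ) (q : 𝕜) : Dn n q := gen n q Gen.b
/-- The generator `c`. -/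
noncomputable def c (n : ℕ) (q : 𝕜) : Dn n q := gen n q Gen.c
/-- The generator `d`. -/
noncomputable def d (n : ℕ) (q : 𝕜) : Dn n q := gen n q Gen.d

section relations

variable (n : ℕ) (q : 𝕜)

theorem b_mul_a : b n q * a n q = q • (a n q * b n q) := by
  simpa using! RingQuot.mkAlgHom_rel 𝕜 (Rel.ba (n := n) (q := q))
theorem d_mul_b : d n q * b n q = q • (b n q * d n q) := by
  simpa using! RingQuot.mkAlgHom_rel 𝕜 (Rel.db (n := n) (q := q))
theorem c_mul_a : c n q * a n q = q • (a n q * c n q) := by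
  simpa using! RingQuot.mkAlgHom_rel 𝕜 (Rel.ca (n := n) (q := q))
theorem d_mul_c : d n q * c n q = q • (c n q * d n q) := by
  simpa using! RingQuot.mkAlgHom_rel 𝕜 (Rel.dc (n := n) (q := q))
theorem b_mul_c : b n q * c n q = c n q * b n q := by
  simpa using! RingQuot.mkAlgHom_rel 𝕜 (Rel.bc (n := n) (q := q))
theorem d_mul_a : d n q * a n q - q • (a n q * d n q) = 1 - b n q * c n q := by
  simpa using! RingQuot.mkAlgHom_rel 𝕜 (Rel.da (n := n) (q := q))
theorem a_pow : a n q ^ n = 0 := by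
  simpa using! RingQuot.mkAlgHom_rel 𝕜 (Rel.a_pow (n := n) (q := q))
theorem d_pow : d n q ^ n = 0 := by
  simpa using! RingQuot.mkAlgHom_rel 𝕜 (Rel.d_pow (n := n) (q := q))
theorem b_pow : b n q ^ n = 1 := by
  simpa using! RingQuot.mkAlgHom_rel 𝕜 (Rel.b_pow (n := n) (q := q))
theorem c_pow : c n q ^ n = 1 := by
  simpa using! RingQuot.mkAlgHom_rel 𝕜 (Rel.c_pow (n := n) (q := q))

end relations

/-- The elements `a, b, c, d` of an algebra satisfy the defining relations of `D_n`. -/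
structure Rels (n : ℕ) (q : 𝕜) {B : Type*} [Ring B] [Algebra 𝕜 B] (a b c d : B) : Prop where
  ba : b * a = q • (a * b)
  db : d * b = q • (b * d)
  ca : c * a = q • (a * c)
  dc : d * c = q • (c * d)
  bc : b * c = c * b
  da : d * a - q • (a * d) = 1 - b * c
  ha : a ^ n = 0
  hd : d ^ n = 0
  hb : b ^ n = 1
  hc : c ^ n = 1

/-- The universal property of `D_n`. -/
noncomputable def lift {n : ℕ} {q : 𝕜} {B : Type*} [Ring B] [Algebra 𝕜 B] {a b c d : B}
    (h : Rels n q a b c d) : Dn n q →ₐ[𝕜] B :=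
  RingQuot.liftAlgHom 𝕜 ⟨FreeAlgebra.lift 𝕜
      (fun g : Gen => match g with | .a => a | .b => b | .c => c | .d => d), by
    obtain ⟨ba, db, ca, dc, bc, da, ha, hd, hb, hc⟩ := h
    intro x y h
    cases h <;> simpa⟩

section lift

variable {n : ℕ} {q : 𝕜} {B : Type*} [Ring B] [Algebra 𝕜 B] {a' b' c' d' : B}
    (h : Rels n q a' b' c' d')

theorem lift_a : lift h (a n q) = a' := by
  rw [lift, a, gen]; exact (RingQuot.liftAlgHom_mkAlgHom_apply _ _ _ _).trans (by simp)
theorem lift_b : lift h (b n q) = b' := by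
  rw [lift, b, gen]; exact (RingQuot.liftAlgHom_mkAlgHom_apply _ _ _ _).trans (by simp)
theorem lift_c : lift h (c n q) = c' := by
  rw [lift, c, gen]; exact (RingQuot.liftAlgHom_mkAlgHom_apply _ _ _ _).trans (by simp)
theorem lift_d : lift h (d n q) = d' := by
  rw [lift, d, gen]; exact (RingQuot.liftAlgHom_mkAlgHom_apply _ _ _ _).trans (by simp)

end lift

theorem algHom_ext {n : ℕ} {q : 𝕜} {B : Type*} [Semiring B] [Algebra 𝕜 B]
    {f g : Dn n q →ₐ[𝕜] B} (ha : f (a n q) = g (a n q)) (hb : f (b n q) = g (b n q))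
    (hc : f (c n q) = g (c n q)) (hd : f (d n q) = g (d n q)) : f = g := by
  refine RingQuot.ringQuot_ext' (S := 𝕜) (s := Rel n q) f g (FreeAlgebra.hom_ext ?_)
  funext x
  cases x
  exacts [ha, hb, hc, hd]

theorem rels_Δ (n : ℕ) (q : 𝕜) [NeZero n] (hq : IsPrimitiveRoot q n) :
    Rels n q (a n q ⊗ₜ[𝕜] b n q + 1 ⊗ₜ[𝕜] a n q) (b n q ⊗ₜ[𝕜] b n q) (c n q ⊗ₜ[𝕜] c n q)
      (d n q ⊗ₜ[𝕜] c n q + 1 ⊗ₜ[𝕜] d n q) where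
  ba := by simp [mul_add, add_mul, b_mul_a, TensorProduct.smul_tmul']
  db := by simp [mul_add, add_mul, d_mul_b, b_mul_c, TensorProduct.smul_tmul']
  ca := by simp [mul_add, add_mul, c_mul_a, b_mul_c, TensorProduct.smul_tmul']
  dc := by simp [mul_add, add_mul, d_mul_c, TensorProduct.smul_tmul']
  bc := by simp [b_mul_c]
  da := by
    have e := d_mul_a n q
    rw [sub_eq_iff_eq_add] at e
    simp only [mul_add, add_mul, Algebra.TensorProduct.tmul_mul_tmul, one_mul, mul_one, e,
      b_mul_c, d_mul_b, c_mul_a, TensorProduct.tmul_add, TensorProduct.add_tmul,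
      TensorProduct.tmul_sub, TensorProduct.sub_tmul, TensorProduct.tmul_smul,
      TensorProduct.smul_tmul', Algebra.TensorProduct.one_def, smul_add]
    abel
  ha := by
    rw [add_comm, add_pow_of_qcomm hq (by simp [b_mul_a, TensorProduct.smul_tmul'])]
    simp [a_pow]
  hd := by
    rw [add_pow_of_qcomm hq (by simp [d_mul_c, TensorProduct.smul_tmul'])]
    simp [d_pow]
  hb := by simp [b_pow, Algebra.TensorProduct.one_def]
  hc := by simp [c_pow, Algebra.TensorProduct.one_def]

/-- The coproduct: `Δ a = a ⊗ b + 1 ⊗ a`, `Δ b = b ⊗ b`, `Δ c = c ⊗ c`,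
`Δ d = d ⊗ c + 1 ⊗ d`. -/
noncomputable def Δ (n : ℕ) (q : 𝕜) [NeZero n] (hq : IsPrimitiveRoot q n) :
    Dn n q →ₐ[𝕜] Dn n q ⊗[𝕜] Dn n q :=
  lift (rels_Δ n q hq)

theorem rels_ε (n : ℕ) (q : 𝕜) [NeZero n] : Rels n q (0 : 𝕜) 1 1 0 := by
  constructor <;> simp [NeZero.ne n]

/-- The counit: `ε a = ε d = 0`, `ε b = ε c = 1`. -/
noncomputable def ε (n : ℕ) (q : 𝕜) [NeZero n] : Dn n q →ₐ[𝕜] 𝕜 :=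
  lift (rels_ε n q)

section
variable (n : ℕ) (q : 𝕜) [NeZero n] (hq : IsPrimitiveRoot q n)

theorem Δ_a : Δ n q hq (a n q) = a n q ⊗ₜ b n q + 1 ⊗ₜ a n q := by rw [Δ, lift_a]
theorem Δ_b : Δ n q hq (b n q) = b n q ⊗ₜ b n q := by rw [Δ, lift_b]
theorem Δ_c : Δ n q hq (c n q) = c n q ⊗ₜ c n q := by rw [Δ, lift_c]
theorem Δ_d : Δ n q hq (d n q) = d n q ⊗ₜ c n q + 1 ⊗ₜ d n q := by rw [Δ, lift_d]
theorem ε_a : ε n q (a n q) = 0 := by rw [ε, lift_a]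
theorem ε_b : ε n q (b n q) = 1 := by rw [ε, lift_b]
theorem ε_c : ε n q (c n q) = 1 := by rw [ε, lift_c]
theorem ε_d : ε n q (d n q) = 0 := by rw [ε, lift_d]

end

/-- The bialgebra structure of `D_n`. (It has an antipode, which is uniquely determined by the
bialgebra structure.) -/
noncomputable instance (n : ℕ) (q : 𝕜) [NeZero n] [hq : Fact (IsPrimitiveRoot q n)] :
    Bialgebra 𝕜 (Dn n q) :=
  Bialgebra.ofAlgHom (Δ n q hq.out) (ε n q)
    (by
      apply algHom_ext <;>
        simp [Δ_a, Δ_b, Δ_c, Δ_d, TensorProduct.add_tmul, TensorProduct.tmul_add,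
          Algebra.TensorProduct.one_def, add_assoc])
    (by apply algHom_ext <;> simp [Δ_a, Δ_b, Δ_c, Δ_d, ε_a, ε_b, ε_c, ε_d])
    (by apply algHom_ext <;> simp [Δ_a, Δ_b, Δ_c, Δ_d, ε_a, ε_b, ε_c, ε_d])

end Dn

/-! ### The simple modules `V(ℓ, r)` -/

/-- The scalars `α_i(ℓ) = (q^i - 1)(1 - q^(i - ℓ)) / (q - 1)`. -/
noncomputable def α (q : 𝕜) (ℓ i : ℕ) : 𝕜 :=
  (q ^ i - 1) * (1 - q ^ ((i : ℤ) - ℓ)) / (q - 1)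

section matrices

variable (q : 𝕜) (ℓ : ℕ)

/-- `a v_j = v_{j+1}`, `a v_ℓ = 0`. The basis vector `v_j` has the index `j - 1 : Fin ℓ`, and
column `j` of a matrix holds the image of the basis vector with the index `j`. -/
def matA : Matrix (Fin ℓ) (Fin ℓ) 𝕜 :=
  Matrix.of fun m j => if (m : ℕ) = j + 1 then 1 else 0

/-- `b v_j = q^(r + j - 1) v_j`. -/
noncomputable def matB (r : ℤ) : Matrix (Fin ℓ) (Fin ℓ) 𝕜 :=
  Matrix.diagonal fun j => q ^ (r + ((j : ℕ) : ℤ))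

/-- `c v_j = q^(j - (r + ℓ)) v_j`. -/
noncomputable def matC (r : ℤ) : Matrix (Fin ℓ) (Fin ℓ) 𝕜 :=
  Matrix.diagonal fun j => q ^ (((j : ℕ) : ℤ) + 1 - (r + ℓ))

/-- `d v_j = α_{j-1}(ℓ) v_{j-1}`, `d v_1 = 0`. -/
noncomputable def matD : Matrix (Fin ℓ) (Fin ℓ) 𝕜 :=
  Matrix.of fun m j => if (m : ℕ) + 1 = j then α q ℓ j else 0

variable {q} {ℓ}

theorem matB_matA (hq : q ≠ 0) (r : ℤ) :
    matB q ℓ r * matA ℓ = q • (matA ℓ * matB q ℓ r) := by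
  ext m j
  simp only [matA, matB, Matrix.diagonal_mul, Matrix.mul_diagonal, Matrix.smul_apply,
    Matrix.of_apply, smul_eq_mul]
  split_ifs with h
  · rw [h, Nat.cast_succ, ← add_assoc, zpow_add_one₀ hq]; ring
  · simp

theorem matC_matA (hq : q ≠ 0) (r : ℤ) :
    matC q ℓ r * matA ℓ = q • (matA ℓ * matC q ℓ r) := by
  ext m j
  simp only [matA, matC, Matrix.diagonal_mul, Matrix.mul_diagonal, Matrix.smul_apply,
    Matrix.of_apply, smul_eq_mul]
  split_ifs with h
  · rw [h, Nat.cast_succ, mul_one, one_mul, ← zpow_one_add₀ hq]; congr 1; ring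
  · simp

theorem matD_matB (hq : q ≠ 0) (r : ℤ) :
    matD q ℓ * matB q ℓ r = q • (matB q ℓ r * matD q ℓ) := by
  ext m j
  simp only [matD, matB, Matrix.diagonal_mul, Matrix.mul_diagonal, Matrix.smul_apply,
    Matrix.of_apply, smul_eq_mul]
  split_ifs with h
  · rw [← h, Nat.cast_succ, ← add_assoc, zpow_add_one₀ hq]; ring
  · simp

theorem matD_matC (hq : q ≠ 0) (r : ℤ) :
    matD q ℓ * matC q ℓ r = q • (matC q ℓ r * matD q ℓ) := by
  ext m j
  simp only [matD, matC, Matrix.diagonal_mul, Matrix.mul_diagonal, Matrix.smul_apply,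
    Matrix.of_apply, smul_eq_mul]
  split_ifs with h
  · rw [← h, Nat.cast_succ, ← mul_assoc, ← zpow_one_add₀ hq, mul_comm]; congr 2; ring
  · simp

theorem matB_matC (r : ℤ) : matB q ℓ r * matC q ℓ r = matC q ℓ r * matB q ℓ r := by
  simp [matB, matC, mul_comm]

theorem matD_matA : matD q ℓ * (matA ℓ : Matrix (Fin ℓ) (Fin ℓ) 𝕜) =
    Matrix.diagonal fun j : Fin ℓ => α q ℓ ((j : ℕ) + 1) := by
  ext m j
  rw [Matrix.mul_apply]
  simp only [matD, matA, Matrix.of_apply, Matrix.diagonal_apply]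
  by_cases h : (j : ℕ) + 1 < ℓ
  · rw [Finset.sum_eq_single ⟨(j : ℕ) + 1, h⟩]
    · simp only [if_true, mul_one, Nat.add_right_cancel_iff, Fin.ext_iff]
      split_ifs with h' <;> simp_all
    · intro x _ hx
      rw [if_neg (fun e => hx (Fin.ext e)), mul_zero]
    · simp
  · have hj : (j : ℕ) + 1 = ℓ := by omega
    have hα : α q ℓ ((j : ℕ) + 1) = 0 := by
      rw [hj, α]; simp
    rw [Finset.sum_eq_zero]
    · split_ifs with h'
      · subst h'; rw [hα]
      · rfl
    · intro x _
      rw [if_neg (by omega : ¬ ((x : ℕ) = j + 1)), mul_zero]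

theorem matA_matD : (matA ℓ : Matrix (Fin ℓ) (Fin ℓ) 𝕜) * matD q ℓ =
    Matrix.diagonal fun j : Fin ℓ => α q ℓ (j : ℕ) := by
  ext m j
  rw [Matrix.mul_apply]
  simp only [matD, matA, Matrix.of_apply, Matrix.diagonal_apply]
  rcases Nat.eq_zero_or_pos (j : ℕ) with h | h
  · have hα : α q ℓ (j : ℕ) = 0 := by rw [h, α]; simp
    rw [Finset.sum_eq_zero]
    · split_ifs with h'
      · subst h'; rw [hα]
      · rfl
    · intro x _
      rw [if_neg (by omega : ¬ ((x : ℕ) + 1 = j)), mul_zero]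
  · rw [Finset.sum_eq_single ⟨(j : ℕ) - 1, by omega⟩]
    · simp only [Fin.ext_iff, Nat.sub_add_cancel h, if_true]
      split_ifs with h' <;> simp_all
    · intro x _ hx
      rw [if_neg (fun e : (x : ℕ) + 1 = j => hx (Fin.ext (by simp; omega))), mul_zero]
    · simp

theorem matDA_sub (hq : q ≠ 0) (r : ℤ) :
    matD q ℓ * matA ℓ - q • (matA ℓ * matD q ℓ) = 1 - matB q ℓ r * matC q ℓ r := by
  rw [matD_matA, matA_matD, matB, matC, Matrix.diagonal_mul_diagonal, ← Matrix.diagonal_one,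
    ← Matrix.diagonal_smul, Matrix.diagonal_sub, Matrix.diagonal_sub]
  congr 1
  funext j
  have e : q ^ (r + ((j : ℕ) : ℤ)) * q ^ (((j : ℕ) : ℤ) + 1 - (r + ℓ)) =
      q ^ (j : ℕ) * q ^ (j : ℕ) * q * (q ^ ℓ)⁻¹ := by
    rw [← zpow_add₀ hq, ← zpow_natCast, ← zpow_natCast q ℓ, ← zpow_neg, ← zpow_add₀ hq,
      ← zpow_add_one₀ hq, ← zpow_add₀ hq]
    congr 1; ring
  have e1 : q ^ ((((j : ℕ) + 1 : ℕ) : ℤ) - ℓ) = q ^ (j : ℕ) * q * (q ^ ℓ)⁻¹ := by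
    rw [zpow_sub₀ hq, zpow_natCast, zpow_natCast, pow_succ, div_eq_mul_inv]
  have e2 : q ^ (((j : ℕ) : ℤ) - ℓ) = q ^ (j : ℕ) * (q ^ ℓ)⁻¹ := by
    rw [zpow_sub₀ hq, zpow_natCast, zpow_natCast, div_eq_mul_inv]
  simp only [Pi.smul_apply, smul_eq_mul]
  rw [e, α, α, e1, e2]
  by_cases h1 : q = 1
  · subst h1; simp
  · have h2 : q - 1 ≠ 0 := sub_ne_zero.2 h1
    have h3 : q ^ ℓ ≠ 0 := pow_ne_zero _ hq
    field_simp
    ring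

theorem matA_pow_apply (p : ℕ) : ∀ m j : Fin ℓ, (m : ℕ) < j + p →
    (matA ℓ ^ p : Matrix (Fin ℓ) (Fin ℓ) 𝕜) m j = 0 := by
  induction p with
  | zero =>
    intro m j h
    rw [pow_zero, Matrix.one_apply_ne (by rintro rfl; omega)]
  | succ p ih =>
    intro m j h
    rw [pow_succ, Matrix.mul_apply]
    refine Finset.sum_eq_zero fun x _ => ?_
    simp only [matA, Matrix.of_apply]
    split_ifs with hx
    · rw [← matA, ih m x (by omega), zero_mul]
    · simp

theorem matD_pow_apply (p : ℕ) : ∀ m j : Fin ℓ, (j : ℕ) < m + p →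
    (matD q ℓ ^ p) m j = 0 := by
  induction p with
  | zero =>
    intro m j h
    rw [pow_zero, Matrix.one_apply_ne (by rintro rfl; omega)]
  | succ p ih =>
    intro m j h
    rw [pow_succ, Matrix.mul_apply]
    refine Finset.sum_eq_zero fun x _ => ?_
    simp only [matD, Matrix.of_apply]
    split_ifs with hx
    · rw [← matD, ih m x (by omega), zero_mul]
    · simp

theorem zpow_pow_eq_one {n : ℕ} (h : q ^ n = 1) (z : ℤ) : (q ^ z) ^ n = 1 := by
  rw [← zpow_natCast, zpow_comm, zpow_natCast, h, one_zpow]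

end matrices

theorem rels_mat {n : ℕ} {q : 𝕜} [NeZero n] (hq : q ^ n = 1) (ℓ : ℕ) (hℓ : ℓ ≤ n) (r : ℤ) :
    Dn.Rels n q (matA ℓ) (matB q ℓ r) (matC q ℓ r) (matD q ℓ) :=
  have h0 : q ≠ 0 := by rintro rfl; simp [NeZero.ne n] at hq
  { ba := matB_matA h0 r
    db := matD_matB h0 r
    ca := matC_matA h0 r
    dc := matD_matC h0 r
    bc := matB_matC r
    da := matDA_sub h0 r
    ha := by ext m j; rw [matA_pow_apply n m j (by omega)]; rfl
    hd := by ext m j; rw [matD_pow_apply n m j (by omega)]; rfl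
    hb := by
      rw [matB, Matrix.diagonal_pow, ← Matrix.diagonal_one]
      congr 1; funext j; exact zpow_pow_eq_one hq _
    hc := by
      rw [matC, Matrix.diagonal_pow, ← Matrix.diagonal_one]
      congr 1; funext j; exact zpow_pow_eq_one hq _ }

/-- The module `V(ℓ, r)`, for `ℓ ≤ n` and `r ∈ ℤ/n`, as a representation of `D_n` on `𝕜^ℓ`. -/
noncomputable def V (n : ℕ) (q : 𝕜) [NeZero n] [hq : Fact (IsPrimitiveRoot q n)] (ℓ : ℕ)
    (hℓ : ℓ ≤ n) (r : ZMod n) : Dn n q →ₐ[𝕜] Module.End 𝕜 (Fin ℓ → 𝕜) :=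
  (Matrix.toLinAlgEquiv' : Matrix (Fin ℓ) (Fin ℓ) 𝕜 ≃ₐ[𝕜] _).toAlgHom.comp
    (Dn.lift (rels_mat hq.out.pow_eq_one ℓ hℓ (r.val : ℤ)))

/-- The family of all simple `D_n`-modules `V(ℓ, r)`, `1 ≤ ℓ ≤ n`, `r ∈ ℤ/n`; the index
`(l, r)` stands for `V(l + 1, r)`. -/
noncomputable def simples (n : ℕ) (q : 𝕜) [NeZero n] [Fact (IsPrimitiveRoot q n)]
    (p : Fin n × ZMod n) : Dn n q →ₐ[𝕜] Module.End 𝕜 (Fin ((p.1 : ℕ) + 1) → 𝕜) :=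
  V n q ((p.1 : ℕ) + 1) p.1.isLt p.2

/-- The trace vector `Tr x` of `x ∈ D_n` on the simple modules `V(ℓ, r)`. -/
noncomputable def Tr (n : ℕ) (q : 𝕜) [NeZero n] [Fact (IsPrimitiveRoot q n)] (x : Dn n q) :
    Fin n × ZMod n → 𝕜 :=
  traceVec (simples n q) x

/-- The McKay matrix of the module `V(2, 0)`, as a linear map `v ↦ M v` on column vectors. -/
noncomputable def M (n : ℕ) (q : 𝕜) [NeZero n] [Fact (IsPrimitiveRoot q n)] (hn : 2 ≤ n) :
    Module.End 𝕜 (Fin n × ZMod n → 𝕜) :=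
  Matrix.toLin' (mcKay (simples n q) (V n q 2 hn 0))

/-- The quantum integer `[m] = 1 + q + ⋯ + q^(m-1)`. -/
def qInt (q : 𝕜) (m : ℕ) : 𝕜 := ∑ t ∈ Finset.range m, q ^ t

end Double

end TaftDouble

/-! Write `y l` for $b^ic^kd^\ell a^\ell$. Everything rests on the fact that `M` turns trace vectors
into trace vectors. Traces add along composition series, and every composition factor of $\mathsf
V(\ell,r)\otimes\mathsf V$ is one of the pairwise non-isomorphic $\mathsf V(\ell',r')$. Hence an
entry of `M (Tr x)` is the trace of `x` on that tensor product, that is, the trace on $\mathsf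
V(\ell,r)$ of the element obtained from $\Delta(x)$ by tracing out the second factor on $\mathsf V$
(`M_Tr`). The ingredients are `sum_compMult_mul_modTrace`, `index_eq_of_equiv`,
`exists_equiv_simples` and `trace_tensorRep`.

On $\mathsf V(2,0)$ both $a$ and $d$ square to zero, so the expansion of
$\Delta(d)^\ell\Delta(a)^\ell$ has few terms, and `M` is bidiagonal on the vectors `Tr (y l)`:
$M\,\mathrm{Tr}(y_\ell)=A_\ell\,\mathrm{Tr}(y_\ell)+B_{\ell-1}\,\mathrm{Tr}(y_{\ell-1})$ with
$A_\ell=q^{-(k+\ell)}+q^{i+\ell}$ (`M_Tr_zero`, `M_Tr_succ`). The choice of $s$ makes $A_s=A_0=\mu$,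
and the recursion for $\gamma$ says exactly that the coefficients of
$\mathrm{Tr}(y_1),\dots,\mathrm{Tr}(y_{s-1})$ in $(M-\mu)w$ vanish (`coefficient_cancel`). What
remains is $\gamma_1B_0\,\mathrm{Tr}(b^ic^k)$, a nonzero multiple of an eigenvector. Finally, the
counit kills every `y l` with $\ell\ge1$, whereas it is $1$ on a grouplike element. -/

namespace TaftDouble

/-! ### Traces along composition series -/

/-- The trace is additive on short exact sequences of endomorphisms. -/
theorem trace_eq_add_of_exact {𝕜 N U Q : Type*} [Field 𝕜] [AddCommGroup N] [Module 𝕜 N]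
    [AddCommGroup U] [Module 𝕜 U] [AddCommGroup Q] [Module 𝕜 Q] [FiniteDimensional 𝕜 N]
    [FiniteDimensional 𝕜 U] [FiniteDimensional 𝕜 Q] (ι : N →ₗ[𝕜] U) (p : U →ₗ[𝕜] Q)
    (hι : Function.Injective ι) (hp : Function.Surjective p) (hex : ∀ u, p u = 0 → ∃ v, ι v = u)
    (hpι : ∀ v, p (ι v) = 0) (f : Module.End 𝕜 U) (g : Module.End 𝕜 N) (h : Module.End 𝕜 Q)
    (hg : ∀ v, f (ι v) = ι (g v)) (hh : ∀ u, p (f u) = h (p u)) :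
    LinearMap.trace 𝕜 U f = LinearMap.trace 𝕜 N g + LinearMap.trace 𝕜 Q h := by
  obtain ⟨s, hs⟩ := p.exists_rightInverse_of_surjective (LinearMap.range_eq_top.2 hp)
  obtain ⟨t, ht⟩ := ι.exists_leftInverse_of_injective (LinearMap.ker_eq_bot.2 hι)
  have hs' : ∀ z, p (s z) = z := fun z => LinearMap.congr_fun hs z
  have ht' : ∀ z, t (ι z) = z := fun z => LinearMap.congr_fun ht z
  -- `r` is the projection onto `N` belonging to the splitting `s`, so the identity of `U` is `ι r +
  -- s p`. Composing with `f` and cycling the factors under the trace leaves `g` and `h`.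
  let r : U →ₗ[𝕜] N := t ∘ₗ (LinearMap.id - s ∘ₗ p)
  have hr : ∀ u, ι (r u) = u - s (p u) := by
    intro u
    obtain ⟨v, hv⟩ := hex (u - s (p u)) (by simp [hs'])
    have : r u = t (u - s (p u)) := rfl
    rw [this, ← hv, ht']
  have e1 : f = (f ∘ₗ ι) ∘ₗ r + (f ∘ₗ s) ∘ₗ p := by
    ext u
    simp only [LinearMap.add_apply, LinearMap.comp_apply, hr, map_sub, sub_add_cancel]
  have e2 : r ∘ₗ (f ∘ₗ ι) = g := by
    ext v
    have : r (ι (g v)) = t (ι (g v) - s (p (ι (g v)))) := rfl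
    simp [hg, this, hpι, ht']
  have e3 : p ∘ₗ (f ∘ₗ s) = h := by
    ext z
    simp [hh, hs']
  conv_lhs => rw [e1]
  rw [map_add, LinearMap.trace_comp_comm' r, LinearMap.trace_comp_comm' p, e2, e3]

section ModuleTrace

variable {𝕜 A : Type*} [Field 𝕜] [Ring A] [Algebra 𝕜 A]

/-- The trace of the action of `x` on the `A`-module `U`. -/
noncomputable def modTrace (𝕜 : Type*) {A : Type*} [Field 𝕜] [Ring A] [Algebra 𝕜 A]
    (U : Type*) [AddCommGroup U] [Module A U] [Module 𝕜 U] [IsScalarTower 𝕜 A U] (x : A) : 𝕜 :=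
  LinearMap.trace 𝕜 U (Algebra.lsmul 𝕜 𝕜 U x)

variable {U : Type*} [AddCommGroup U] [Module A U] [Module 𝕜 U] [IsScalarTower 𝕜 A U]
  {U' : Type*} [AddCommGroup U'] [Module A U'] [Module 𝕜 U'] [IsScalarTower 𝕜 A U']

theorem modTrace_congr (e : U ≃ₗ[A] U') (x : A) : modTrace 𝕜 U x = modTrace 𝕜 U' x := by
  rw [modTrace, modTrace, ← LinearMap.trace_conj' _ (e.restrictScalars 𝕜)]
  congr 1
  ext v
  simp [LinearEquiv.conj_apply]

theorem modTrace_of_subsingleton [Subsingleton U] (x : A) : modTrace 𝕜 U x = 0 := by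
  rw [modTrace, Subsingleton.elim (Algebra.lsmul 𝕜 𝕜 U x) 0, map_zero]

theorem modTrace_eq_add [FiniteDimensional 𝕜 U] (N : Submodule A U) (x : A) :
    modTrace 𝕜 U x = modTrace 𝕜 N x + modTrace 𝕜 (U ⧸ N) x := by
  have : FiniteDimensional 𝕜 N :=
    FiniteDimensional.of_injective (N.subtype.restrictScalars 𝕜) Subtype.val_injective
  have : FiniteDimensional 𝕜 (U ⧸ N) :=
    Module.Finite.of_surjective (N.mkQ.restrictScalars 𝕜) (Submodule.mkQ_surjective N)
  refine trace_eq_add_of_exact (N.subtype.restrictScalars 𝕜) (N.mkQ.restrictScalars 𝕜)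
    Subtype.val_injective (Submodule.mkQ_surjective N) (fun u hu => ?_) (fun u => ?_) _ _ _
    (fun u => rfl) (fun u => rfl)
  · exact ⟨⟨u, (Submodule.Quotient.mk_eq_zero N).1 hu⟩, rfl⟩
  · exact (Submodule.Quotient.mk_eq_zero N).2 u.2

theorem modTrace_last [FiniteDimensional 𝕜 U] (c : CompositionSeries (Submodule A U))
    (h₀ : c.head = ⊥) (x : A) : modTrace 𝕜 c.last x =
      ∑ i : Fin c.length,
        modTrace 𝕜 (c i.succ ⧸ (c i.castSucc).comap (c i.succ).subtype) x := by
  have step : ∀ i : Fin c.length, modTrace 𝕜 (c i.succ) x = modTrace 𝕜 (c i.castSucc) x +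
      modTrace 𝕜 (c i.succ ⧸ (c i.castSucc).comap (c i.succ).subtype) x := by
    intro i
    have : FiniteDimensional 𝕜 (c i.succ) := FiniteDimensional.of_injective
      ((c i.succ).subtype.restrictScalars 𝕜) Subtype.val_injective
    rw [modTrace_eq_add ((c i.castSucc).comap (c i.succ).subtype) x]
    congr 1
    exact modTrace_congr (Submodule.comapSubtypeEquivOfLe (c.lt_succ i).le) x
  have key : ∀ m : ℕ, ∀ hm : m ≤ c.length, modTrace 𝕜 (c ⟨m, by omega⟩) x =
      ∑ i : Fin m, modTrace 𝕜 (c (i.castLE hm).succ ⧸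
        (c (i.castLE hm).castSucc).comap (c (i.castLE hm).succ).subtype) x := by
    intro m
    induction m with
    | zero =>
      intro _
      have e : c ⟨0, by omega⟩ = ⊥ := h₀
      have : Subsingleton (c ⟨0, by omega⟩) := by rw [e]; infer_instance
      exact (modTrace_of_subsingleton x).trans (by simp)
    | succ m ih =>
      intro hm
      rw [Fin.sum_univ_castSucc]
      exact (step ⟨m, hm⟩).trans (congrArg (· + _) (ih (by omega)))
  exact key c.length le_rfl

/-- Each factor of a composition series of `U` is isomorphic to exactly one `X i`, so grouping the
factors by `i` turns additivity of the trace into a sum weighted by multiplicities. The hypothesis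
`hU` ranges over subquotients of `U` because these are the modules that occur as factors. -/
theorem sum_compMult_mul_modTrace {I : Type*} [Fintype I] [FiniteDimensional 𝕜 U] {X : I → Type*}
    [∀ i, AddCommGroup (X i)] [∀ i, Module A (X i)] [∀ i, Module 𝕜 (X i)]
    [∀ i, IsScalarTower 𝕜 A (X i)]
    (hX : ∀ i j, Nonempty (X i ≃ₗ[A] X j) → i = j)
    (hU : ∀ (N' : Submodule A U) (N : Submodule A N'), IsSimpleModule A (N' ⧸ N) →
      ∃ i, Nonempty ((N' ⧸ N) ≃ₗ[A] X i)) (x : A) :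
    ∑ i, (compMult A U (X i) : 𝕜) * modTrace 𝕜 (X i) x = modTrace 𝕜 U x := by
  classical
  have : IsNoetherian A U := isNoetherian_of_tower 𝕜 inferInstance
  have : IsArtinian A U := isArtinian_of_tower 𝕜 inferInstance
  obtain ⟨c, h₀, h₁⟩ := exists_compositionSeries_of_isNoetherian_isArtinian A U
  have hf : ∀ m : Fin c.length, ∃ i,
      Nonempty ((c m.succ ⧸ (c m.castSucc).comap (c m.succ).subtype) ≃ₗ[A] X i) := fun m =>
    hU _ _ ((covBy_iff_quot_is_simple (c.lt_succ m).le).1 (c.step m))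
  choose p hp using hf
  have hiff : ∀ m i,
      Nonempty ((c m.succ ⧸ (c m.castSucc).comap (c m.succ).subtype) ≃ₗ[A] X i) ↔ p m = i := by
    refine fun m i => ⟨fun ⟨g⟩ => ?_, ?_⟩
    · obtain ⟨g'⟩ := hp m
      exact hX _ _ ⟨g'.symm.trans g⟩
    · rintro rfl
      exact hp m
  have hU' : modTrace 𝕜 U x = modTrace 𝕜 c.last x := by
    rw [h₁]
    exact modTrace_congr Submodule.topEquiv.symm x
  rw [hU', modTrace_last c h₀]
  have e1 : ∀ i, (compMult A U (X i) : 𝕜) * modTrace 𝕜 (X i) x =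
      ∑ m, if p m = i then modTrace 𝕜 (X i) x else 0 := by
    intro i
    rw [compMult_eq c h₀ h₁, factorCount, Nat.card_congr (Equiv.subtypeEquivRight fun m =>
      hiff m i), Nat.card_eq_fintype_card, Fintype.card_subtype, ← Finset.sum_filter,
      Finset.sum_const, nsmul_eq_mul]
  simp_rw [e1]
  rw [Finset.sum_comm]
  refine Finset.sum_congr rfl fun m _ => ?_
  rw [Finset.sum_ite_eq Finset.univ (p m), if_pos (Finset.mem_univ _)]
  exact (modTrace_congr (hp m).some x).symm

end ModuleTrace

section RepModule

variable {𝕜 A V : Type*} [Field 𝕜] [Ring A] [Algebra 𝕜 A] [AddCommGroup V] [Module 𝕜 V]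
  (ρ : A →ₐ[𝕜] Module.End 𝕜 V)

instance : Module 𝕜 (RepModule ρ) := inferInstanceAs (Module 𝕜 V)

theorem RepModule.smul_def (x : A) (v : RepModule ρ) : x • v = (ρ x (v : V) : V) := rfl

instance : IsScalarTower 𝕜 A (RepModule ρ) where
  smul_assoc t x v := by
    simp only [RepModule.smul_def, map_smul]
    rfl

instance [FiniteDimensional 𝕜 V] : FiniteDimensional 𝕜 (RepModule ρ) :=
  inferInstanceAs (FiniteDimensional 𝕜 V)

theorem modTrace_repModule (x : A) : modTrace 𝕜 (RepModule ρ) x = LinearMap.trace 𝕜 V (ρ x) := rfl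

end RepModule

end TaftDouble

namespace TaftDouble

/-! ### The modules V(ℓ, r) and the classification of simple modules -/

section Simples

variable {𝕜 : Type*} [Field 𝕜]

/-- The quotient map from the free algebra onto `D_n`. -/
noncomputable def Dn.mk (n : ℕ) (q : 𝕜) : FreeAlgebra 𝕜 Gen →ₐ[𝕜] Dn n q :=
  RingQuot.mkAlgHom 𝕜 (Rel n q)

theorem Dn.mk_surjective (n : ℕ) (q : 𝕜) : Function.Surjective (Dn.mk n q) :=
  RingQuot.mkAlgHom_surjective 𝕜 (Rel n q)

theorem Dn.map_smul_of_gens {n : ℕ} {q : 𝕜} {P Q : Type*} [AddCommGroup P] [Module 𝕜 P]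
    [Module (Dn n q) P] [IsScalarTower 𝕜 (Dn n q) P] [AddCommGroup Q] [Module 𝕜 Q]
    [Module (Dn n q) Q] [IsScalarTower 𝕜 (Dn n q) Q] (φ : P →ₗ[𝕜] Q)
    (ha : ∀ v, φ (Dn.a n q • v) = Dn.a n q • φ v) (hb : ∀ v, φ (Dn.b n q • v) = Dn.b n q • φ v)
    (hc : ∀ v, φ (Dn.c n q • v) = Dn.c n q • φ v) (hd : ∀ v, φ (Dn.d n q • v) = Dn.d n q • φ v)
    (x : Dn n q) (v : P) : φ (x • v) = x • φ v := by
  obtain ⟨y, rfl⟩ := Dn.mk_surjective n q x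
  induction y using FreeAlgebra.induction generalizing v with
  | grade0 t => rw [AlgHom.commutes, algebraMap_smul, algebraMap_smul, map_smul]
  | grade1 g =>
    cases g
    exacts [ha v, hb v, hc v, hd v]
  | mul y z hy hz => rw [map_mul, mul_smul, mul_smul, hy, hz]
  | add y z hy hz => rw [map_add, add_smul, add_smul, map_add, hy, hz]

theorem α_zero (q : 𝕜) (ℓ : ℕ) : α q ℓ 0 = 0 := by simp [α]

theorem α_self (q : 𝕜) (ℓ : ℕ) : α q ℓ ℓ = 0 := by simp [α]

/-- This is the recursion produced by moving `d` past one more `a` with $da=q\,ad+1-bc$, where $bc$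
acts on $a^je$ by $q^{2j}q^{-m}$. -/
theorem α_succ {q : 𝕜} (h0 : q ≠ 0) (h1 : q ≠ 1) (m j : ℕ) :
    α q (m + 1) (j + 1) = q * α q (m + 1) j + (1 - q ^ (2 * j) * (q ^ m)⁻¹) := by
  have h2 : q - 1 ≠ 0 := sub_ne_zero.2 h1
  have h3 : q ^ m ≠ 0 := pow_ne_zero _ h0
  have e1 : q ^ (((j + 1 : ℕ) : ℤ) - (m + 1 : ℕ)) = q ^ j * (q ^ m)⁻¹ := by
    rw [zpow_sub₀ h0, zpow_natCast, zpow_natCast]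
    field_simp
    ring
  have e2 : q ^ ((j : ℤ) - (m + 1 : ℕ)) = q ^ j * (q ^ m)⁻¹ * q⁻¹ := by
    rw [zpow_sub₀ h0, zpow_natCast, zpow_natCast, pow_succ]
    field_simp
  rw [α, α, e1, e2]
  field_simp
  ring

theorem α_ne_zero {q : 𝕜} {n : ℕ} (hq : IsPrimitiveRoot q n) {ℓ j : ℕ} (hℓ : ℓ ≤ n) (hj : 0 < j)
    (hjℓ : j < ℓ) : α q ℓ j ≠ 0 := by
  have hn : n ≠ 0 := by omega
  have h1 : q ≠ 1 := hq.ne_one (by omega)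
  have h2 : q ^ j ≠ 1 := hq.pow_ne_one_of_pos_of_lt hj.ne' (by omega)
  have h3 : q ^ (ℓ - j) ≠ 1 := hq.pow_ne_one_of_pos_of_lt (by omega) (by omega)
  have h4 : q ^ ((j : ℤ) - ℓ) ≠ 1 := by
    intro h
    apply h3
    rw [← inv_inj, ← zpow_natCast, ← zpow_neg, inv_one, ← h]
    congr 1
    omega
  exact div_ne_zero (mul_ne_zero (sub_ne_zero.2 h2) (sub_ne_zero.2 h4.symm)) (sub_ne_zero.2 h1)

/-- A nonzero vector of a `D_n`-module generates a nonzero vector that is killed by `d`. -/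
theorem exists_d_smul_eq_zero {n : ℕ} {q : 𝕜} {Q : Type*} [AddCommGroup Q] [Module (Dn n q) Q] 
    {v : Q} (hv : v ≠ 0) : ∃ m : ℕ, Dn.d n q ^ m • v ≠ 0 ∧ Dn.d n q • (Dn.d n q ^ m • v) = 0 := by
  classical
  have hex : ∃ m : ℕ, Dn.d n q ^ m • v = 0 := ⟨n, by rw [Dn.d_pow, zero_smul]⟩
  obtain ⟨m, hm⟩ : ∃ m, Nat.find hex = m + 1 := by
    refine Nat.exists_eq_succ_of_ne_zero fun h => hv ?_
    have := Nat.find_spec hex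
    rwa [h, pow_zero, one_smul] at this
  refine ⟨m, Nat.find_min hex (by omega), ?_⟩
  rw [← mul_smul, ← pow_succ', ← hm]
  exact Nat.find_spec hex

theorem b_smul_a_pow_smul {n : ℕ} {q : 𝕜} {Q : Type*} [AddCommGroup Q] [Module 𝕜 Q]
    [Module (Dn n q) Q] [IsScalarTower 𝕜 (Dn n q) Q] {e : Q} {β : 𝕜} (hb : Dn.b n q • e = β • e)
    (j : ℕ) :
    Dn.b n q • (Dn.a n q ^ j • e) = (q ^ j * β) • (Dn.a n q ^ j • e) := by
  rw [← mul_smul, mul_pow_of_qcomm (Dn.b_mul_a n q), smul_assoc, mul_smul, hb, smul_comm _ β,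
    smul_smul]

theorem c_smul_a_pow_smul {n : ℕ} {q : 𝕜} {Q : Type*} [AddCommGroup Q] [Module 𝕜 Q]
    [Module (Dn n q) Q] [IsScalarTower 𝕜 (Dn n q) Q] {e : Q} {κ : 𝕜} (hc : Dn.c n q • e = κ • e)
    (j : ℕ) :
    Dn.c n q • (Dn.a n q ^ j • e) = (q ^ j * κ) • (Dn.a n q ^ j • e) := by
  rw [← mul_smul, mul_pow_of_qcomm (Dn.c_mul_a n q), smul_assoc, mul_smul, hc, smul_comm _ κ,
    smul_smul]

/-- A joint eigenvector of $b$ and $c$ killed by $d$ generates, under $a$, a string with the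
structure constants of $\mathsf V(m+1,r)$; the integer $m$ is read off from the eigenvalue $q^{-m}$
of $bc$. -/
theorem d_smul_a_pow_succ_smul {n : ℕ} {q : 𝕜} {Q : Type*} [AddCommGroup Q] [Module 𝕜 Q]
    [Module (Dn n q) Q] [IsScalarTower 𝕜 (Dn n q) Q] {e : Q} {β κ : 𝕜} (h0 : q ≠ 0) (h1 : q ≠ 1)
    (hd : Dn.d n q • e = 0)
    (hb : Dn.b n q • e = β • e) (hc : Dn.c n q • e = κ • e) {m : ℕ} (hm : β * κ * q ^ m = 1)
    (j : ℕ) : Dn.d n q • (Dn.a n q ^ (j + 1) • e) =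
      α q (m + 1) (j + 1) • (Dn.a n q ^ j • e) := by
  have hm' : β * κ = (q ^ m)⁻¹ := eq_inv_of_mul_eq_one_left hm
  have hda : Dn.d n q * Dn.a n q =
      1 - Dn.b n q * Dn.c n q + q • (Dn.a n q * Dn.d n q) := by
    rw [← Dn.d_mul_a, sub_add_cancel]
  have step : ∀ j, Dn.d n q • (Dn.a n q ^ (j + 1) • e) =
      q • (Dn.a n q • (Dn.d n q • (Dn.a n q ^ j • e))) +
        (1 - q ^ (2 * j) * (q ^ m)⁻¹) • (Dn.a n q ^ j • e) := by
    intro j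
    rw [pow_succ', mul_smul, ← mul_smul, hda, add_smul, sub_smul, one_smul, mul_smul,
      c_smul_a_pow_smul hc, smul_comm, b_smul_a_pow_smul hb, smul_smul, smul_assoc, mul_smul,
      sub_smul, one_smul, add_comm, ← hm']
    rw [mul_smul (Dn.a n q), smul_smul (q ^ j * κ),
      show q ^ j * κ * (q ^ j * β) = q ^ (2 * j) * (β * κ) by ring]
  induction j with
  | zero =>
    rw [step, pow_zero, one_smul, hd, smul_zero, smul_zero, zero_add, α_succ h0 h1, α_zero]
    simp
  | succ j ih =>
    rw [step, ih, smul_comm (Dn.a n q), ← mul_smul (Dn.a n q), ← pow_succ', smul_smul, ← add_smul,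
      ← α_succ h0 h1]

variable {n : ℕ} {q : 𝕜} [NeZero n] [hq : Fact (IsPrimitiveRoot q n)] {ℓ : ℕ} {hℓ : ℓ ≤ n}
  {r : ZMod n}

theorem V_a : V n q ℓ hℓ r (Dn.a n q) = Matrix.toLin' (matA ℓ) := by
  rw [V, AlgHom.comp_apply, Dn.lift_a]; rfl
theorem V_b : V n q ℓ hℓ r (Dn.b n q) = Matrix.toLin' (matB q ℓ r.val) := by
  rw [V, AlgHom.comp_apply, Dn.lift_b]; rfl
theorem V_c : V n q ℓ hℓ r (Dn.c n q) = Matrix.toLin' (matC q ℓ r.val) := by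
  rw [V, AlgHom.comp_apply, Dn.lift_c]; rfl
theorem V_d : V n q ℓ hℓ r (Dn.d n q) = Matrix.toLin' (matD q ℓ) := by
  rw [V, AlgHom.comp_apply, Dn.lift_d]; rfl

/-- The basis vector of `V(ℓ, r)` with the index `j`; it is `0` for `j ≥ ℓ`. -/
def vec (𝕜 : Type*) [Field 𝕜] (ℓ j : ℕ) : Fin ℓ → 𝕜 := fun m => if (m : ℕ) = j then 1 else 0

theorem vec_coe (j : Fin ℓ) : vec 𝕜 ℓ j = Pi.single j 1 := by
  ext m
  simp [vec, Pi.single_apply, Fin.ext_iff]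

theorem vec_of_le {j : ℕ} (h : ℓ ≤ j) : vec 𝕜 ℓ j = 0 := by
  ext m
  simp only [vec, Pi.zero_apply, ite_eq_right_iff, one_ne_zero]
  omega

theorem a_vec (j : ℕ) : V n q ℓ hℓ r (Dn.a n q) (vec 𝕜 ℓ j) = vec 𝕜 ℓ (j + 1) := by
  by_cases hj : j < ℓ
  · rw [V_a, show vec 𝕜 ℓ j = _ from vec_coe ⟨j, hj⟩]
    ext m
    simp [matA, vec]
  · rw [vec_of_le (by omega), vec_of_le (by omega), map_zero]

theorem b_apply (v : Fin ℓ → 𝕜) (j : Fin ℓ) :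
    V n q ℓ hℓ r (Dn.b n q) v j = q ^ ((r.val : ℤ) + (j : ℕ)) * v j := by
  rw [V_b, Matrix.toLin'_apply, matB, Matrix.mulVec_diagonal]

theorem c_apply (v : Fin ℓ → 𝕜) (j : Fin ℓ) :
    V n q ℓ hℓ r (Dn.c n q) v j = q ^ (((j : ℕ) : ℤ) + 1 - ((r.val : ℤ) + ℓ)) * v j := by
  rw [V_c, Matrix.toLin'_apply, matC, Matrix.mulVec_diagonal]

theorem d_apply (v : Fin ℓ → 𝕜) (m j : Fin ℓ) (h : (m : ℕ) + 1 = j) :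
    V n q ℓ hℓ r (Dn.d n q) v m = α q ℓ j * v j := by
  rw [V_d, Matrix.toLin'_apply, Matrix.mulVec, dotProduct, Finset.sum_eq_single j]
  · simp [matD, h]
  · intro x _ hx
    rw [matD, Matrix.of_apply, if_neg, zero_mul]
    exact fun e => hx (Fin.ext (e.symm.trans h))
  · simp

theorem b_vec (j : ℕ) :
    V n q ℓ hℓ r (Dn.b n q) (vec 𝕜 ℓ j) = q ^ ((r.val : ℤ) + j) • vec 𝕜 ℓ j := by
  ext m
  rw [b_apply, Pi.smul_apply, smul_eq_mul, vec]
  split_ifs with h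
  · rw [h]
  · simp

theorem c_vec (j : ℕ) : V n q ℓ hℓ r (Dn.c n q) (vec 𝕜 ℓ j) =
    q ^ ((j : ℤ) + 1 - ((r.val : ℤ) + ℓ)) • vec 𝕜 ℓ j := by
  ext m
  rw [c_apply, Pi.smul_apply, smul_eq_mul, vec]
  split_ifs with h
  · rw [h]
  · simp

theorem d_vec_zero : V n q ℓ hℓ r (Dn.d n q) (vec 𝕜 ℓ 0) = 0 := by
  by_cases hj : 0 < ℓ
  · rw [V_d, show vec 𝕜 ℓ 0 = _ from vec_coe ⟨0, hj⟩]
    ext m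
    simp [matD]
  · rw [vec_of_le (by omega), map_zero]

theorem d_vec_succ (j : ℕ) :
    V n q ℓ hℓ r (Dn.d n q) (vec 𝕜 ℓ (j + 1)) = α q ℓ (j + 1) • vec 𝕜 ℓ j := by
  rcases lt_trichotomy (j + 1) ℓ with hj | hj | hj
  · rw [V_d, show vec 𝕜 ℓ (j + 1) = _ from vec_coe ⟨j + 1, hj⟩]
    ext m
    simp [matD, vec]
  · rw [vec_of_le hj.ge, map_zero, hj, α_self, zero_smul]
  · rw [vec_of_le (by omega), vec_of_le (by omega), map_zero, smul_zero]

theorem sum_smul_vec (v : Fin ℓ → 𝕜) : v = ∑ j : Fin ℓ, v j • vec 𝕜 ℓ j := by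
  ext m
  simp [vec_coe, Finset.sum_apply, Pi.single_apply]

/-- The scalars $\alpha_j(\ell)$ with $0<j<\ell$ are nonzero, so $d$ detects every coordinate except
the first. -/
theorem eq_smul_vec_zero_of_d_eq_zero (v : Fin ℓ → 𝕜) (h0 : 0 < ℓ)
    (h : V n q ℓ hℓ r (Dn.d n q) v = 0) : v = v ⟨0, h0⟩ • vec 𝕜 ℓ 0 := by
  ext m
  rcases m with ⟨_ | m, hm⟩
  · simp [vec]
  · have := congrFun h ⟨m, by omega⟩
    rw [d_apply v ⟨m, by omega⟩ ⟨m + 1, hm⟩ rfl, Pi.zero_apply, mul_eq_zero] at this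
    simpa [vec] using this.resolve_left (α_ne_zero hq.out hℓ (by simp) hm)

variable (n q ℓ hℓ r) in
/-- The basis vector `vec 𝕜 ℓ j` as an element of the module `V(ℓ, r)`. -/
def bvec (j : ℕ) : RepModule (V n q ℓ hℓ r) := vec 𝕜 ℓ j

variable (n q ℓ hℓ r) in
/-- The coordinates of an element of `V(ℓ, r)`. -/
noncomputable def coord : RepModule (V n q ℓ hℓ r) ≃ₗ[𝕜] (Fin ℓ → 𝕜) := LinearEquiv.refl 𝕜 _

theorem a_smul_bvec (j : ℕ) : Dn.a n q • bvec n q ℓ hℓ r j = bvec n q ℓ hℓ r (j + 1) := a_vec (hℓ := hℓ) j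

theorem b_smul_bvec (j : ℕ) :
    Dn.b n q • bvec n q ℓ hℓ r j = q ^ ((r.val : ℤ) + j) • bvec n q ℓ hℓ r j := b_vec (hℓ := hℓ) j

theorem c_smul_bvec (j : ℕ) : Dn.c n q • bvec n q ℓ hℓ r j =
    q ^ ((j : ℤ) + 1 - ((r.val : ℤ) + ℓ)) • bvec n q ℓ hℓ r j := c_vec (hℓ := hℓ) j

theorem d_smul_bvec_zero : Dn.d n q • bvec n q ℓ hℓ r 0 = 0 := d_vec_zero (hℓ := hℓ) (r := r)

theorem d_smul_bvec_succ (j : ℕ) :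
    Dn.d n q • bvec n q ℓ hℓ r (j + 1) = α q ℓ (j + 1) • bvec n q ℓ hℓ r j := d_vec_succ (hℓ := hℓ) j

theorem bvec_ne_zero {j : ℕ} (hj : j < ℓ) : bvec n q ℓ hℓ r j ≠ 0 := fun h => by
  simpa [vec] using congrFun (show vec 𝕜 ℓ j = 0 from h) ⟨j, hj⟩

theorem bvec_of_le {j : ℕ} (hj : ℓ ≤ j) : bvec n q ℓ hℓ r j = 0 := vec_of_le hj

theorem sum_coord_smul_bvec (v : RepModule (V n q ℓ hℓ r)) :
    ∑ j : Fin ℓ, coord n q ℓ hℓ r v j • bvec n q ℓ hℓ r j = v :=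
  (sum_smul_vec (coord n q ℓ hℓ r v)).symm

theorem exists_eq_smul_bvec_zero {v : RepModule (V n q ℓ hℓ r)} (h0 : 0 < ℓ)
    (h : Dn.d n q • v = 0) : ∃ t : 𝕜, v = t • bvec n q ℓ hℓ r 0 :=
  ⟨_, eq_smul_vec_zero_of_d_eq_zero (hℓ := hℓ) (r := r) (coord n q ℓ hℓ r v) h0 h⟩

/-- Powers of $d$ carry any nonzero vector to a nonzero multiple of the first basis vector, and
powers of $a$ recover the whole basis from it. -/
theorem isSimpleModule_V (h0 : 0 < ℓ) : IsSimpleModule (Dn n q) (RepModule (V n q ℓ hℓ r)) := by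
  rw [isSimpleModule_iff_toSpanSingleton_surjective]
  refine ⟨⟨⟨bvec n q ℓ hℓ r 0, 0, bvec_ne_zero h0⟩⟩, fun v hv w => ?_⟩
  let N : Submodule (Dn n q) (RepModule (V n q ℓ hℓ r)) := Submodule.span (Dn n q) {v}
  obtain ⟨m, hm, hdm⟩ := exists_d_smul_eq_zero (n := n) (q := q) hv
  have huN : Dn.d n q ^ m • v ∈ N := N.smul_mem _ (Submodule.mem_span_singleton_self v)
  obtain ⟨t, ht⟩ := exists_eq_smul_bvec_zero h0 hdm
  have ht0 : t ≠ 0 := by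
    rintro rfl
    exact hm (by rw [ht, zero_smul])
  have hvec : ∀ j, bvec n q ℓ hℓ r j ∈ N := by
    intro j
    induction j with
    | zero =>
      rw [← inv_smul_smul₀ ht0 (bvec n q ℓ hℓ r 0), ← ht]
      exact N.smul_of_tower_mem _ huN
    | succ j ih =>
      rw [← a_smul_bvec]
      exact N.smul_mem _ ih
  have hw : w ∈ N := by
    rw [← sum_coord_smul_bvec w]
    exact N.sum_mem fun j _ => N.smul_of_tower_mem _ (hvec j)
  obtain ⟨x, hx⟩ := Submodule.mem_span_singleton.1 hw
  exact ⟨x, hx⟩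

/-- An isomorphism preserves the line killed by $d$, and the eigenvalue of $b$ on this line is
$q^r$, which determines $r$ modulo $n$. -/
theorem eq_of_V_equiv_V {r' : ZMod n} (h0 : 0 < ℓ)
    (e : RepModule (V n q ℓ hℓ r) ≃ₗ[Dn n q] RepModule (V n q ℓ hℓ r')) : r = r' := by
  let v := bvec n q ℓ hℓ r 0
  let v' := bvec n q ℓ hℓ r' 0
  obtain ⟨t, ht⟩ : ∃ t : 𝕜, e v = t • v' := by
    refine exists_eq_smul_bvec_zero h0 ?_
    rw [← map_smul, d_smul_bvec_zero, map_zero]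
  have hev : e v ≠ 0 := e.map_ne_zero_iff.2 (bvec_ne_zero h0)
  have hb : q ^ (r.val : ℤ) • e v = q ^ (r'.val : ℤ) • e v := by
    have h1 : Dn.b n q • e v = q ^ (r.val : ℤ) • e v := by
      rw [← map_smul, b_smul_bvec, Nat.cast_zero, add_zero]
      exact (e.restrictScalars 𝕜).map_smul _ _
    have h2 : Dn.b n q • e v = q ^ (r'.val : ℤ) • e v := by
      rw [ht, smul_comm, b_smul_bvec, Nat.cast_zero, add_zero, smul_comm]
    rw [← h1, h2]
  have hr := smul_left_injective 𝕜 hev hb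
  rw [zpow_natCast, zpow_natCast] at hr
  exact ZMod.val_injective n (hq.out.pow_inj (ZMod.val_lt r) (ZMod.val_lt r') hr)

theorem index_eq_of_equiv {p p' : Fin n × ZMod n}
    (h : Nonempty (RepModule (simples n q p) ≃ₗ[Dn n q] RepModule (simples n q p'))) :
    p = p' := by
  obtain ⟨e⟩ := h
  obtain ⟨l, r⟩ := p
  obtain ⟨l', r'⟩ := p'
  have hl : l = l' := by
    have h1 : Module.finrank 𝕜 (Fin ((l : ℕ) + 1) → 𝕜) =
      Module.finrank 𝕜 (Fin ((l' : ℕ) + 1) → 𝕜) := (e.restrictScalars 𝕜).finrank_eq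
    rw [Module.finrank_fin_fun, Module.finrank_fin_fun] at h1
    exact Fin.ext (by omega)
  subst hl
  exact congrArg (Prod.mk l) (eq_of_V_equiv_V (Nat.succ_pos _) e)

/-! ### Recognizing a simple module from a vector killed by d -/

section HighestWeight

variable {Q : Type*} [AddCommGroup Q] [Module 𝕜 Q] [Module (Dn n q) Q]
  [IsScalarTower 𝕜 (Dn n q) Q] {e : Q} {β κ : 𝕜}

/-- Sending the $j$-th basis vector to $a^je$ defines a nonzero homomorphism from $\mathsf V(m+1,r)$
to `Q`; between simple modules it is an isomorphism. Here $r$ comes from $\beta=q^r$, and the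
condition on $\beta\kappa$ then fixes the eigenvalue of $c$. -/
theorem exists_equiv_of_a_pow_smul_eq_zero [IsSimpleModule (Dn n q) Q] (hn : 1 < n) (he : e ≠ 0)
    (hd : Dn.d n q • e = 0) (hb : Dn.b n q • e = β • e) (hc : Dn.c n q • e = κ • e) {m : ℕ}
    (hmn : m < n) (hm : β * κ * q ^ m = 1) (ha : Dn.a n q ^ (m + 1) • e = 0) :
    ∃ p, Nonempty (Q ≃ₗ[Dn n q] RepModule (simples n q p)) := by
  have h0 : q ≠ 0 := hq.out.ne_zero (by omega)
  have h1 : q ≠ 1 := hq.out.ne_one hn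
  have hβ : β ^ n = 1 := by
    have : ∀ j : ℕ, Dn.b n q ^ j • e = β ^ j • e := by
      intro j
      induction j with
      | zero => simp
      | succ j ih => rw [pow_succ, mul_smul, hb, smul_comm, ih, smul_smul, pow_succ']
    refine smul_left_injective 𝕜 he ?_
    show β ^ n • e = (1 : 𝕜) • e
    rw [← this, Dn.b_pow, one_smul, one_smul]
  obtain ⟨t, ht, rfl⟩ := hq.out.eq_pow_of_pow_eq_one hβ
  let r : ZMod n := t
  have hr : r.val = t := ZMod.val_cast_of_lt ht
  have hκ : κ = (q ^ t)⁻¹ * (q ^ m)⁻¹ := by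
    field_simp
    rw [← hm]
    ring
  let bv := bvec n q (m + 1) hmn r
  let φ : RepModule (V n q (m + 1) hmn r) →ₗ[𝕜] Q :=
    Fintype.linearCombination 𝕜 (fun j : Fin (m + 1) => Dn.a n q ^ (j : ℕ) • e) ∘ₗ
      (coord n q (m + 1) hmn r).toLinearMap
  -- Beyond the top of the string both sides vanish, the right one by `ha`; this makes `φ` commute
  -- with $a$ at the last basis vector too.
  have hφ : ∀ j, φ (bv j) = Dn.a n q ^ j • e := by
    intro j
    by_cases hj : j < m + 1
    · have : φ (bv j) = Fintype.linearCombination 𝕜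
          (fun j : Fin (m + 1) => Dn.a n q ^ (j : ℕ) • e) (vec 𝕜 (m + 1) (⟨j, hj⟩ : Fin (m + 1))) :=
        rfl
      rw [this, vec_coe, Fintype.linearCombination_apply_single, one_smul]
    · obtain ⟨i, rfl⟩ := Nat.exists_eq_add_of_le' (not_lt.1 hj)
      rw [show bv (i + (m + 1)) = 0 from bvec_of_le (not_lt.1 hj), map_zero, pow_add, mul_smul, ha,
        smul_zero]
  have ext_bv : ∀ x : Dn n q, (∀ j, φ (x • bv j) = x • φ (bv j)) →
      ∀ v, φ (x • v) = x • φ v := by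
    intro x hx v
    have hv : ∑ j : Fin (m + 1), coord n q (m + 1) hmn r v j • bv j = v :=
      sum_coord_smul_bvec (n := n) (q := q) (hℓ := hmn) (r := r) v
    rw [← hv]
    simp only [Finset.smul_sum, map_sum, smul_comm x, map_smul, hx]
  let Φ : RepModule (V n q (m + 1) hmn r) →ₗ[Dn n q] Q :=
    { toFun := φ
      map_add' := φ.map_add
      map_smul' := by
        refine Dn.map_smul_of_gens φ (ext_bv _ fun j => ?_) (ext_bv _ fun j => ?_)
          (ext_bv _ fun j => ?_) (ext_bv _ fun j => ?_)
        · rw [show Dn.a n q • bv j = _ from a_smul_bvec j, hφ, hφ, ← mul_smul, pow_succ']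
        · rw [show Dn.b n q • bv j = _ from b_smul_bvec j, map_smul, hφ, b_smul_a_pow_smul hb, hr,
            zpow_add₀ h0, zpow_natCast, zpow_natCast, mul_comm]
        · rw [show Dn.c n q • bv j = _ from c_smul_bvec j, map_smul, hφ, c_smul_a_pow_smul hc, hr,
            hκ]
          congr 1
          rw [Nat.cast_succ, show (j : ℤ) + 1 - (t + (m + 1)) = j - t - m by ring,
            zpow_sub₀ h0, zpow_sub₀ h0, zpow_natCast, zpow_natCast, zpow_natCast]
          field_simp
        · cases j with
          | zero =>
            rw [show Dn.d n q • bv 0 = _ from d_smul_bvec_zero, map_zero, hφ, pow_zero, one_smul,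
              hd]
          | succ j =>
            rw [show Dn.d n q • bv (j + 1) = _ from d_smul_bvec_succ j, map_smul, hφ, hφ,
              d_smul_a_pow_succ_smul h0 h1 hd hb hc hm] }
  have hΦ : Φ ≠ 0 := by
    intro h
    have h2 := hφ 0
    rw [show φ (bv 0) = 0 from LinearMap.congr_fun h (bv 0), pow_zero, one_smul] at h2
    exact he h2.symm
  have : IsSimpleModule (Dn n q) (RepModule (V n q (m + 1) hmn r)) := isSimpleModule_V (Nat.succ_pos m)
  exact ⟨(⟨m, hmn⟩, r), ⟨(LinearEquiv.ofBijective Φ (LinearMap.bijective_of_ne_zero hΦ)).symm⟩⟩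

end HighestWeight

theorem exists_mem_hasEigenvector [IsAlgClosed 𝕜] {Q : Type*} [AddCommGroup Q] [Module 𝕜 Q]
    [FiniteDimensional 𝕜 Q] {W : Submodule 𝕜 Q} (hW : W ≠ ⊥) (f : Module.End 𝕜 Q)
    (hf : ∀ v ∈ W, f v ∈ W) : ∃ μ : 𝕜, ∃ v ∈ W, v ≠ 0 ∧ f v = μ • v := by
  have : Nontrivial W := Submodule.nontrivial_iff_ne_bot.2 hW
  obtain ⟨μ, hμ⟩ := Module.End.exists_eigenvalue (f.restrict hf)
  obtain ⟨v, hv⟩ := hμ.exists_hasEigenvector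
  exact ⟨μ, v, v.2, fun h => hv.2 (Subtype.ext h), congrArg Subtype.val hv.apply_eq_smul⟩

/-- Every finite-dimensional simple `D_n`-module is isomorphic to some `V(ℓ, r)`. -/
theorem exists_equiv_simples [IsAlgClosed 𝕜] (hn : 1 < n) (Q : Type*) [AddCommGroup Q]
    [Module 𝕜 Q] [Module (Dn n q) Q] [IsScalarTower 𝕜 (Dn n q) Q] [FiniteDimensional 𝕜 Q]
    [IsSimpleModule (Dn n q) Q] :
    ∃ p, Nonempty (Q ≃ₗ[Dn n q] RepModule (simples n q p)) := by
  have h0 : q ≠ 0 := hq.out.ne_zero (by omega)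
  have : Nontrivial Q := IsSimpleModule.nontrivial (Dn n q) Q
  let act : Dn n q → Module.End 𝕜 Q := fun x => Algebra.lsmul 𝕜 𝕜 Q x
  have hW : LinearMap.ker (act (Dn.d n q)) ≠ ⊥ := by
    obtain ⟨v, hv⟩ := exists_ne (0 : Q)
    obtain ⟨m, hm, hdm⟩ := exists_d_smul_eq_zero (n := n) (q := q) hv
    exact fun h => hm ((Submodule.eq_bot_iff _).1 h _ hdm)
  obtain ⟨β, v, hdv, hv, hbv⟩ := exists_mem_hasEigenvector hW (act (Dn.b n q)) (by
    intro v (hv : Dn.d n q • v = 0)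
    show Dn.d n q • (Dn.b n q • v) = 0
    rw [← mul_smul, Dn.d_mul_b, smul_assoc, mul_smul, hv, smul_zero, smul_zero])
  -- Since $c$ commutes with $b$ and $q$-commutes with $d$, it preserves `W`; an eigenvector of $c$
  -- in `W` is then a joint eigenvector killed by $d$.
  let W := LinearMap.ker (act (Dn.d n q)) ⊓ LinearMap.ker (act (Dn.b n q) - β • (1 : Module.End 𝕜 Q))
  have hW' : W ≠ ⊥ := by
    refine fun h => hv ((Submodule.eq_bot_iff _).1 h _ ⟨hdv, ?_⟩)
    show act (Dn.b n q) v - β • v = 0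
    rw [hbv, sub_self]
  obtain ⟨κ, e, ⟨hde, hbe⟩, he, hce⟩ := exists_mem_hasEigenvector hW' (act (Dn.c n q)) (by
    rintro v ⟨hv, hv'⟩
    replace hv : Dn.d n q • v = 0 := hv
    replace hv' : Dn.b n q • v = β • v := sub_eq_zero.1 hv'
    refine ⟨?_, ?_⟩
    · show Dn.d n q • (Dn.c n q • v) = 0
      rw [← mul_smul, Dn.d_mul_c, smul_assoc, mul_smul, hv, smul_zero, smul_zero]
    · show Dn.b n q • (Dn.c n q • v) - β • (Dn.c n q • v) = 0
      rw [← mul_smul, Dn.b_mul_c, mul_smul, hv', smul_comm, sub_self])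
  replace hde : Dn.d n q • e = 0 := hde
  replace hbe : Dn.b n q • e = β • e := sub_eq_zero.1 hbe
  replace hce : Dn.c n q • e = κ • e := hce
  have hβκ : ((β * κ)⁻¹) ^ n = 1 := by
    have h2 : ∀ j : ℕ, (Dn.b n q * Dn.c n q) ^ j • e = (β * κ) ^ j • e := by
      intro j
      induction j with
      | zero => simp
      | succ j ih =>
        rw [pow_succ, mul_smul, mul_smul, hce, smul_comm (Dn.b n q), hbe, smul_smul, smul_comm, ih,
          smul_smul, pow_succ', mul_comm κ]
    have h3 : (β * κ) ^ n = 1 := by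
      refine smul_left_injective 𝕜 he ?_
      show (β * κ) ^ n • e = (1 : 𝕜) • e
      rw [← h2, (show Commute (Dn.b n q) (Dn.c n q) from Dn.b_mul_c n q).mul_pow, Dn.b_pow,
        Dn.c_pow, one_mul, one_smul, one_smul]
    rw [inv_pow, h3, inv_one]
  obtain ⟨m, hmn, hm⟩ := hq.out.eq_pow_of_pow_eq_one hβκ
  have hβκ0 : β * κ ≠ 0 := by
    intro h
    rw [h, inv_zero] at hm
    exact pow_ne_zero _ h0 hm
  have hm1 : β * κ * q ^ m = 1 := by rw [hm, mul_inv_cancel₀ hβκ0]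
  -- If $a^{m+1}e\ne0$, this vector is again killed by $d$, because $\alpha_{m+1}(m+1)=0$, and can
  -- replace $e$. Its eigenvalue of $bc$ is $q^{2(m+1)}q^{-m}=q^{m+2}$, so the new length parameter
  -- is $n-m-2$, and its string ends in time because $a^{n-m-1}a^{m+1}=a^n=0$.
  by_cases ha : Dn.a n q ^ (m + 1) • e = 0
  · exact exists_equiv_of_a_pow_smul_eq_zero hn he hde hbe hce hmn hm1 ha
  · have hmn' : m + 1 < n := by
      by_contra h
      exact ha (by rw [show m + 1 = n by omega, Dn.a_pow, zero_smul])
    refine exists_equiv_of_a_pow_smul_eq_zero hn ha (m := n - m - 2) ?_ (b_smul_a_pow_smul hbe _)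
      (c_smul_a_pow_smul hce _) (by omega) ?_ ?_
    · rw [d_smul_a_pow_succ_smul h0 (hq.out.ne_one hn) hde hbe hce hm1, α_self, zero_smul]
    · have h4 : q ^ (n - m - 2) * (q ^ m * q ^ 2) = 1 := by
        rw [← pow_add, ← pow_add, show n - m - 2 + (m + 2) = n by omega, hq.out.pow_eq_one]
      rw [show q ^ (m + 1) * β * (q ^ (m + 1) * κ) * q ^ (n - m - 2) =
        (β * κ * q ^ m) * (q ^ (n - m - 2) * (q ^ m * q ^ 2)) by ring, hm1, h4, one_mul]
    · rw [← mul_smul, ← pow_add, show n - m - 2 + 1 + (m + 1) = n by omega, Dn.a_pow, zero_smul]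

end Simples

end TaftDouble

namespace TaftDouble

/-! ### Traces on tensor products through the coproduct -/

section PartialTrace

variable {𝕜 : Type*} [Field 𝕜]

/-- The partial trace `x ⊗ g ↦ tr(g) x`. -/
noncomputable def partialTrace (𝕜 A W : Type*) [Field 𝕜] [Ring A] [Algebra 𝕜 A] [AddCommGroup W]
    [Module 𝕜 W] : A ⊗[𝕜] Module.End 𝕜 W →ₗ[𝕜] A :=
  (TensorProduct.rid 𝕜 A).toLinearMap ∘ₗ (LinearMap.trace 𝕜 W).lTensor A

/-- The coproduct of a bialgebra, followed by a representation on the second factor. -/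
noncomputable def comulRep {A W : Type*} [Ring A] [Bialgebra 𝕜 A] [AddCommGroup W] [Module 𝕜 W]
    (σ : A →ₐ[𝕜] Module.End 𝕜 W) : A →ₐ[𝕜] A ⊗[𝕜] Module.End 𝕜 W :=
  (Algebra.TensorProduct.map (AlgHom.id 𝕜 A) σ).comp (Bialgebra.comulAlgHom 𝕜 A)

theorem partialTrace_tmul {A W : Type*} [Ring A] [Algebra 𝕜 A] [AddCommGroup W] [Module 𝕜 W]
    (x : A) (g : Module.End 𝕜 W) :
    partialTrace 𝕜 A W (x ⊗ₜ g) = LinearMap.trace 𝕜 W g • x := by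
  simp [partialTrace]

/-- On pure tensors this is multiplicativity of the trace. It isolates the dependence on `ρ`, so one
element of `A` serves all simple modules at once. -/
theorem trace_tensorRep {A V W : Type*} [Ring A] [Bialgebra 𝕜 A] [AddCommGroup V] [Module 𝕜 V]
    [FiniteDimensional 𝕜 V] [AddCommGroup W] [Module 𝕜 W] [FiniteDimensional 𝕜 W]
    (ρ : A →ₐ[𝕜] Module.End 𝕜 V) (σ : A →ₐ[𝕜] Module.End 𝕜 W) (x : A) :
    LinearMap.trace 𝕜 (V ⊗[𝕜] W) (tensorRep ρ σ x) =
      LinearMap.trace 𝕜 V (ρ (partialTrace 𝕜 A W (comulRep σ x))) := by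
  have key : ∀ z : A ⊗[𝕜] A, LinearMap.trace 𝕜 (V ⊗[𝕜] W)
      (Module.endTensorEndAlgHom (R := 𝕜) (S := 𝕜) (A := 𝕜) (M := V) (N := W)
        (Algebra.TensorProduct.map ρ σ z)) =
      LinearMap.trace 𝕜 V (ρ (partialTrace 𝕜 A W
        (Algebra.TensorProduct.map (AlgHom.id 𝕜 A) σ z))) := by
    intro z
    induction z using TensorProduct.induction_on with
    | zero => simp only [map_zero]
    | add y z hy hz => simp only [map_add, hy, hz]
    | tmul x y =>
      rw [Algebra.TensorProduct.map_tmul, Algebra.TensorProduct.map_tmul, partialTrace_tmul,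
        map_smul, map_smul, smul_eq_mul, mul_comm]
      exact LinearMap.trace_tensorProduct' (ρ x) (σ y)
  exact key _

end PartialTrace

/-! ### Powers of q-commuting sums with a square-zero term -/

section QCommuting

variable {𝕜 B : Type*} [Field 𝕜] [Ring B] [Algebra 𝕜 B] {q : 𝕜} {x y : B}

theorem qInt_succ (q : 𝕜) (m : ℕ) : qInt q (m + 1) = 1 + q * qInt q m := by
  rw [qInt, Finset.sum_range_succ', qInt, Finset.mul_sum, pow_zero, add_comm]
  simp [pow_succ']

theorem qInt_eq {q : 𝕜} (h1 : q ≠ 1) (m : ℕ) : qInt q m = (q ^ m - 1) / (q - 1) :=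
  geom_sum_eq h1 m

/-- Only terms with at most one factor `y` survive, and moving that factor to the right past the
powers of `x` contributes $1+q+\dots+q^m$. This form serves $\Delta(d)$; the mirror image below
serves $\Delta(a)$. -/
theorem add_pow_succ_of_mul_self_right (h : y * x = q • (x * y)) (hy : y * y = 0) (m : ℕ) :
    (x + y) ^ (m + 1) = x ^ (m + 1) + qInt q (m + 1) • (x ^ m * y) := by
  induction m with
  | zero => simp [qInt]
  | succ m ih =>
    rw [pow_succ, ih, qInt_succ q (m + 1), add_smul, one_smul, mul_smul, mul_add, add_mul, add_mul,
      smul_mul_assoc, smul_mul_assoc, mul_assoc _ y, mul_assoc _ y, hy, h, mul_zero, smul_zero,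
      add_zero, mul_smul_comm, ← mul_assoc, ← pow_succ, ← pow_succ, smul_comm _ q]
    abel

theorem add_pow_succ_of_mul_self_left (h : y * x = q • (x * y)) (hx : x * x = 0) (m : ℕ) :
    (x + y) ^ (m + 1) = y ^ (m + 1) + qInt q (m + 1) • (x * y ^ m) := by
  induction m with
  | zero => simp [qInt, add_comm]
  | succ m ih =>
    rw [pow_succ', ih, qInt_succ q (m + 1), add_smul, one_smul, mul_smul, mul_add, add_mul, add_mul,
      mul_smul_comm, mul_smul_comm, ← mul_assoc x x, ← mul_assoc y x, hx, h, zero_mul, smul_zero,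
      zero_add, smul_mul_assoc, mul_assoc x y, ← pow_succ', ← pow_succ', smul_comm _ q]
    abel

end QCommuting

/-! ### The McKay matrix on trace vectors -/

section McKay

variable {𝕜 : Type*} [Field 𝕜] {n : ℕ} {q : 𝕜} [NeZero n] [hq : Fact (IsPrimitiveRoot q n)]

theorem M_Tr [IsAlgClosed 𝕜] (hn : 2 ≤ n) (x : Dn n q) : M n q hn (Tr n q x) =
    Tr n q (partialTrace 𝕜 (Dn n q) (Fin 2 → 𝕜) (comulRep (V n q 2 hn 0) x)) := by
  funext p
  have h := sum_compMult_mul_modTrace (𝕜 := 𝕜) (A := Dn n q)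
    (U := RepModule (tensorRep (simples n q p) (V n q 2 hn 0)))
    (X := fun p => RepModule (simples n q p)) (fun _ _ => index_eq_of_equiv)
    (fun N' N _ => by
      have : FiniteDimensional 𝕜 N' :=
        FiniteDimensional.of_injective (N'.subtype.restrictScalars 𝕜) Subtype.val_injective
      have : FiniteDimensional 𝕜 (N' ⧸ N) :=
        Module.Finite.of_surjective (N.mkQ.restrictScalars 𝕜) (Submodule.mkQ_surjective N)
      exact exists_equiv_simples (by omega) (N' ⧸ N)) x
  rw [modTrace_repModule, trace_tensorRep] at h
  exact h

/-- The representation `V(2, 0)` in matrix form. -/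
theorem V_two_gens (hn : 2 ≤ n) :
    V n q 2 hn 0 (Dn.a n q) = Matrix.toLinAlgEquiv' !![0, 0; 1, 0] ∧
    V n q 2 hn 0 (Dn.b n q) = Matrix.toLinAlgEquiv' (Matrix.diagonal ![1, q]) ∧
    V n q 2 hn 0 (Dn.c n q) = Matrix.toLinAlgEquiv' (Matrix.diagonal ![q⁻¹, 1]) ∧
    V n q 2 hn 0 (Dn.d n q) = Matrix.toLinAlgEquiv' !![0, 1 - q⁻¹; 0, 0] := by
  have h1 : q - 1 ≠ 0 := sub_ne_zero.2 (hq.out.ne_one (by omega))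
  have hα : α q 2 1 = 1 - q⁻¹ := by
    rw [α, pow_one, mul_div_cancel_left₀ _ h1]
    norm_num
  refine ⟨?_, ?_, ?_, ?_⟩
  · refine V_a.trans (congrArg Matrix.toLin' ?_)
    ext m j
    fin_cases m <;> fin_cases j <;> simp [matA]
  · refine V_b.trans (congrArg Matrix.toLin' ?_)
    rw [matB, ZMod.val_zero]
    congr 1
    ext j
    fin_cases j <;> simp
  · refine V_c.trans (congrArg Matrix.toLin' ?_)
    rw [matC, ZMod.val_zero]
    congr 1
    ext j
    fin_cases j <;> simp
  · refine V_d.trans (congrArg Matrix.toLin' ?_)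
    ext m j
    fin_cases m <;> fin_cases j <;> simp [matD, hα]

theorem comulRep_gens (hn : 2 ≤ n) :
    comulRep (V n q 2 hn 0) (Dn.a n q) =
      1 ⊗ₜ V n q 2 hn 0 (Dn.a n q) + Dn.a n q ⊗ₜ V n q 2 hn 0 (Dn.b n q) ∧
    comulRep (V n q 2 hn 0) (Dn.b n q) = Dn.b n q ⊗ₜ V n q 2 hn 0 (Dn.b n q) ∧
    comulRep (V n q 2 hn 0) (Dn.c n q) = Dn.c n q ⊗ₜ V n q 2 hn 0 (Dn.c n q) ∧
    comulRep (V n q 2 hn 0) (Dn.d n q) =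
      Dn.d n q ⊗ₜ V n q 2 hn 0 (Dn.c n q) + 1 ⊗ₜ V n q 2 hn 0 (Dn.d n q) := by
  have hΔ : ∀ x, Bialgebra.comulAlgHom 𝕜 (Dn n q) x = Dn.Δ n q hq.out x := fun x => rfl
  simp only [comulRep, AlgHom.comp_apply, hΔ, Dn.Δ_a, Dn.Δ_b, Dn.Δ_c, Dn.Δ_d, map_add,
    Algebra.TensorProduct.map_tmul, AlgHom.id_apply, map_one, and_self, and_true]
  rw [add_comm]

theorem trace_toLinAlgEquiv' {m : ℕ} (A : Matrix (Fin m) (Fin m) 𝕜) :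
    LinearMap.trace 𝕜 (Fin m → 𝕜) (Matrix.toLinAlgEquiv' A) = A.trace :=
  Matrix.trace_toLin'_eq A

variable (n q) in
/-- The trace vector, as a linear map. -/
noncomputable def TrLin : Dn n q →ₗ[𝕜] Fin n × ZMod n → 𝕜 :=
  LinearMap.pi fun p => LinearMap.trace 𝕜 _ ∘ₗ (simples n q p).toLinearMap

theorem TrLin_apply (x : Dn n q) : TrLin n q x = Tr n q x := rfl

theorem M_Tr_zero [IsAlgClosed 𝕜] (hn : 2 ≤ n) (i k : ℕ) :
    M n q hn (Tr n q (Dn.b n q ^ i * Dn.c n q ^ k)) =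
      ((q ^ k)⁻¹ + q ^ i) • Tr n q (Dn.b n q ^ i * Dn.c n q ^ k) := by
  obtain ⟨-, hb, hc, -⟩ := V_two_gens (q := q) hn
  obtain ⟨-, hb', hc', -⟩ := comulRep_gens (q := q) hn
  have ht : LinearMap.trace 𝕜 (Fin 2 → 𝕜) (V n q 2 hn 0 (Dn.b n q) ^ i *
      V n q 2 hn 0 (Dn.c n q) ^ k) = (q ^ k)⁻¹ + q ^ i := by
    simp only [hb, hc, ← map_pow, ← map_mul, trace_toLinAlgEquiv', Matrix.diagonal_pow,
      Matrix.trace_fin_two]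
    simp
  rw [M_Tr, map_mul, map_pow, map_pow, hb', hc', Algebra.TensorProduct.tmul_pow,
    Algebra.TensorProduct.tmul_pow, Algebra.TensorProduct.tmul_mul_tmul, partialTrace_tmul, ht,
    ← TrLin_apply, map_smul, TrLin_apply]

/-- The diagonal term takes the group-like parts of both $\Delta(d)^{l+1}$ and $\Delta(a)^{l+1}$ in
the second factor. The lower term takes one $d$ and one $a$ there, and each of the two choices
contributes a factor $[l+1]$. -/
theorem M_Tr_succ [IsAlgClosed 𝕜] (hn : 2 ≤ n) (i k l : ℕ) :
    M n q hn (Tr n q (Dn.b n q ^ i * Dn.c n q ^ k * Dn.d n q ^ (l + 1) * Dn.a n q ^ (l + 1))) =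
      ((q ^ (k + (l + 1)))⁻¹ + q ^ (i + (l + 1))) •
        Tr n q (Dn.b n q ^ i * Dn.c n q ^ k * Dn.d n q ^ (l + 1) * Dn.a n q ^ (l + 1)) +
      (qInt q (l + 1) ^ 2 * ((q ^ (k + l))⁻¹ * (1 - q⁻¹))) •
        Tr n q (Dn.b n q ^ i * Dn.c n q ^ k * Dn.d n q ^ l * Dn.a n q ^ l) := by
  obtain ⟨ha, hb, hc, hd⟩ := V_two_gens (q := q) hn
  obtain ⟨ha', hb', hc', hd'⟩ := comulRep_gens (q := q) hn
  set σ := V n q 2 hn 0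
  have haa : σ (Dn.a n q) * σ (Dn.a n q) = 0 := by
    rw [ha, ← map_mul, show (!![0, 0; 1, 0] * !![0, 0; 1, 0] : Matrix (Fin 2) (Fin 2) 𝕜) = 0 by
      ext m j; fin_cases m <;> fin_cases j <;> simp, map_zero]
  have hdd : σ (Dn.d n q) * σ (Dn.d n q) = 0 := by
    rw [hd, ← map_mul, show (!![0, 1 - q⁻¹; 0, 0] * !![0, 1 - q⁻¹; 0, 0] : Matrix (Fin 2) (Fin 2) 𝕜) = 0 by
      ext m j; fin_cases m <;> fin_cases j <;> simp, map_zero]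
  have hba : σ (Dn.b n q) * σ (Dn.a n q) = q • (σ (Dn.a n q) * σ (Dn.b n q)) := by
    rw [← map_mul, Dn.b_mul_a, map_smul, map_mul]
  have hdc : σ (Dn.d n q) * σ (Dn.c n q) = q • (σ (Dn.c n q) * σ (Dn.d n q)) := by
    rw [← map_mul, Dn.d_mul_c, map_smul, map_mul]
  have hD := add_pow_succ_of_mul_self_right (q := q) (x := Dn.d n q ⊗ₜ[𝕜] σ (Dn.c n q))
    (y := 1 ⊗ₜ[𝕜] σ (Dn.d n q)) (by simp [hdc]) (by simp [hdd]) l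
  have hA := add_pow_succ_of_mul_self_left (q := q) (x := 1 ⊗ₜ[𝕜] σ (Dn.a n q))
    (y := Dn.a n q ⊗ₜ[𝕜] σ (Dn.b n q)) (by simp [hba]) (by simp [haa]) l
  have t1 : LinearMap.trace 𝕜 (Fin 2 → 𝕜) (σ (Dn.b n q) ^ i * σ (Dn.c n q) ^ k *
      σ (Dn.c n q) ^ (l + 1) * σ (Dn.b n q) ^ (l + 1)) =
        (q ^ (k + (l + 1)))⁻¹ + q ^ (i + (l + 1)) := by
    simp only [hb, hc, ← map_pow, ← map_mul, trace_toLinAlgEquiv', Matrix.diagonal_pow,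
      Matrix.trace_fin_two]
    simp [pow_add, mul_comm, mul_assoc, mul_left_comm]
  -- In `t2` and `t3` a single off-diagonal matrix stands among diagonal ones, so the trace is zero.
  -- In `t4` only the first basis vector contributes: there $b$ acts by $1$, $c$ by $q^{-1}$ and
  -- $da$ by $1-q^{-1}$.
  have t2 : LinearMap.trace 𝕜 (Fin 2 → 𝕜) (σ (Dn.b n q) ^ i * σ (Dn.c n q) ^ k *
      σ (Dn.c n q) ^ (l + 1) * (σ (Dn.a n q) * σ (Dn.b n q) ^ l)) = 0 := by
    simp only [ha, hb, hc, ← map_pow, ← map_mul, trace_toLinAlgEquiv', Matrix.diagonal_pow,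
      Matrix.trace_fin_two, Matrix.diagonal_mul_diagonal, Matrix.diagonal_mul,
      Matrix.mul_diagonal]
    simp
  have t3 : LinearMap.trace 𝕜 (Fin 2 → 𝕜) (σ (Dn.b n q) ^ i * σ (Dn.c n q) ^ k *
      (σ (Dn.c n q) ^ l * σ (Dn.d n q)) * σ (Dn.b n q) ^ (l + 1)) = 0 := by
    simp only [hd, hb, hc, ← map_pow, ← map_mul, trace_toLinAlgEquiv', Matrix.diagonal_pow,
      Matrix.trace_fin_two, Matrix.diagonal_mul_diagonal, Matrix.diagonal_mul,
      Matrix.mul_diagonal]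
    simp
  have t4 : LinearMap.trace 𝕜 (Fin 2 → 𝕜) (σ (Dn.b n q) ^ i * σ (Dn.c n q) ^ k *
      (σ (Dn.c n q) ^ l * σ (Dn.d n q)) * (σ (Dn.a n q) * σ (Dn.b n q) ^ l)) =
        (q ^ (k + l))⁻¹ * (1 - q⁻¹) := by
    simp only [ha, hd, hb, hc, ← map_pow, ← map_mul, trace_toLinAlgEquiv', Matrix.diagonal_pow,
      Matrix.trace_fin_two, Matrix.diagonal_mul_diagonal, Matrix.mul_apply (M := _ * _),
      Fin.sum_univ_two, Matrix.diagonal_mul, Matrix.mul_diagonal]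
    simp [pow_add, mul_comm, mul_assoc, mul_left_comm]
  have e : comulRep σ (Dn.b n q ^ i * Dn.c n q ^ k * Dn.d n q ^ (l + 1) * Dn.a n q ^ (l + 1)) =
      (Dn.b n q ^ i * Dn.c n q ^ k * Dn.d n q ^ (l + 1) * Dn.a n q ^ (l + 1)) ⊗ₜ
        (σ (Dn.b n q) ^ i * σ (Dn.c n q) ^ k * σ (Dn.c n q) ^ (l + 1) * σ (Dn.b n q) ^ (l + 1)) +
      qInt q (l + 1) • ((Dn.b n q ^ i * Dn.c n q ^ k * Dn.d n q ^ (l + 1) * Dn.a n q ^ l) ⊗ₜ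
        (σ (Dn.b n q) ^ i * σ (Dn.c n q) ^ k * σ (Dn.c n q) ^ (l + 1) *
          (σ (Dn.a n q) * σ (Dn.b n q) ^ l))) +
      (qInt q (l + 1) • ((Dn.b n q ^ i * Dn.c n q ^ k * Dn.d n q ^ l * Dn.a n q ^ (l + 1)) ⊗ₜ
        (σ (Dn.b n q) ^ i * σ (Dn.c n q) ^ k * (σ (Dn.c n q) ^ l * σ (Dn.d n q)) *
          σ (Dn.b n q) ^ (l + 1))) +
      (qInt q (l + 1) * qInt q (l + 1)) •
        ((Dn.b n q ^ i * Dn.c n q ^ k * Dn.d n q ^ l * Dn.a n q ^ l) ⊗ₜ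
        (σ (Dn.b n q) ^ i * σ (Dn.c n q) ^ k * (σ (Dn.c n q) ^ l * σ (Dn.d n q)) *
          (σ (Dn.a n q) * σ (Dn.b n q) ^ l)))) := by
    simp only [map_mul, map_pow, ha', hb', hc', hd', hD, hA, Algebra.TensorProduct.tmul_pow,
      Algebra.TensorProduct.tmul_mul_tmul, mul_one, one_mul, mul_add, add_mul, mul_smul_comm,
      smul_mul_assoc, smul_smul, smul_add]
    abel
  rw [M_Tr, e]
  simp only [map_add, map_smul, partialTrace_tmul, t1, t2, t3, t4, zero_smul, smul_zero, add_zero,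
    zero_add, ← TrLin_apply, smul_smul]
  rw [pow_two]

end McKay

end TaftDouble

namespace TaftDouble

/-! ### The coefficients γ and the generalized eigenvector -/

section Eigenvectors

variable {𝕜 : Type*} [Field 𝕜] {n : ℕ} {q : 𝕜}

theorem qInt_ne_zero (hq : IsPrimitiveRoot q n) {m : ℕ} (hm : 0 < m) (hmn : m < n) :
    qInt q m ≠ 0 := by
  rw [qInt_eq (hq.ne_one (by omega))]
  exact div_ne_zero (sub_ne_zero.2 (hq.pow_ne_one_of_pos_of_lt hm.ne' hmn))
    (sub_ne_zero.2 (hq.ne_one (by omega)))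

/-- The coefficients `γ` cancel the terms of the generalized eigenvector in pairs. -/
theorem coefficient_cancel (hq : IsPrimitiveRoot q n) {i k s m : ℕ} (hm : 1 ≤ m) (hms : m < s)
    (hsn : s < n) (hs : q ^ s * (q ^ i * q ^ k) = 1) {g g' : 𝕜}
    (hg : g = qInt q (m + 1) ^ 2 * q ^ (-1 - (m : ℤ) + s) /
        (qInt q m * qInt q (s - m) * (q - 1)) * g') :
    g * ((q ^ (k + m))⁻¹ + q ^ (i + m) - ((q ^ k)⁻¹ + q ^ i)) +
      g' * (qInt q (m + 1) ^ 2 * ((q ^ (k + m))⁻¹ * (1 - q⁻¹))) = 0 := by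
  obtain ⟨t, rfl⟩ : ∃ t, s = m + t := ⟨s - m, by omega⟩
  have h0 : q ≠ 0 := hq.ne_zero (by omega)
  have h1 : q ≠ 1 := hq.ne_one (by omega)
  have h2 : q - 1 ≠ 0 := sub_ne_zero.2 h1
  have hP : q ^ m - 1 ≠ 0 := sub_ne_zero.2 (hq.pow_ne_one_of_pos_of_lt (by omega) (by omega))
  have hT : q ^ t - 1 ≠ 0 := sub_ne_zero.2 (hq.pow_ne_one_of_pos_of_lt (by omega) (by omega))
  have e1 : q ^ (-1 - (m : ℤ) + (m + t : ℕ)) = q ^ t * q⁻¹ := by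
    rw [Nat.cast_add, show -1 - (m : ℤ) + (m + t) = t - 1 by ring, zpow_sub₀ h0, zpow_natCast,
      zpow_one, div_eq_mul_inv]
  -- With $P=q^m$ and $T=q^t$, where $t=s-m$, eliminating $q^k$ gives $A_m-\mu=-q^i(P-1)(T-1)$.
  -- These two factors cancel against $[m]\,[s-m]$ in the denominator of the recursion.
  have e2 : (q ^ (k + m))⁻¹ = q ^ i * q ^ t := by
    refine (eq_inv_of_mul_eq_one_left ?_).symm
    rw [← hs]
    ring
  have e3 : (q ^ k)⁻¹ = q ^ i * q ^ m * q ^ t := by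
    refine (eq_inv_of_mul_eq_one_left ?_).symm
    rw [← hs]
    ring
  rw [hg, e1, e2, e3, Nat.add_sub_cancel_left, qInt_eq h1 m, qInt_eq h1 t, pow_add q i m]
  generalize qInt q (m + 1) = x
  generalize q ^ m = P at *
  generalize q ^ t = T at *
  field_simp
  ring

theorem counit_b_c_d_a_eq_zero [NeZero n] [hq : Fact (IsPrimitiveRoot q n)] {i k l : ℕ}
    (hl : l ≠ 0) : Coalgebra.counit (R := 𝕜)
      (Dn.b n q ^ i * Dn.c n q ^ k * Dn.d n q ^ l * Dn.a n q ^ l) = 0 := by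
  show Dn.ε n q (Dn.b n q ^ i * Dn.c n q ^ k * Dn.d n q ^ l * Dn.a n q ^ l) = 0
  rw [map_mul, map_pow _ (Dn.a n q), Dn.ε_a, zero_pow hl, mul_zero]

/-- The entry at the trivial module $\mathsf V(1,0)$ is $1$. -/
theorem Tr_b_pow_mul_c_pow_ne_zero [NeZero n] [hq : Fact (IsPrimitiveRoot q n)] (i k : ℕ) :
    Tr n q (Dn.b n q ^ i * Dn.c n q ^ k) ≠ 0 := by
  intro h
  have h1 : LinearMap.trace 𝕜 (Fin 1 → 𝕜)
      (V n q 1 (NeZero.pos n) 0 (Dn.b n q ^ i * Dn.c n q ^ k)) = 0 :=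
    congrFun h (⟨0, NeZero.pos n⟩, 0)
  have hb : V n q 1 (NeZero.pos n) 0 (Dn.b n q) = 1 := by
    ext v j
    fin_cases j
    simp [b_apply]
  have hc : V n q 1 (NeZero.pos n) 0 (Dn.c n q) = 1 := by
    ext v j
    fin_cases j
    simp [c_apply]
  rw [map_mul, map_pow, map_pow, hb, hc, one_pow, one_pow, one_mul, LinearMap.trace_one] at h1
  simp at h1

end Eigenvectors

end TaftDouble

open TaftDouble in
theorem theorem3p8 {𝕜 : Type*} [Field 𝕜] [IsAlgClosed 𝕜] [CharZero 𝕜] (n : ℕ) [NeZero n]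
    (hn : 3 ≤ n) (hodd : Odd n) (q : 𝕜) [Fact (IsPrimitiveRoot q n)] (i k : ℕ) (hi : i ≤ n - 1)
    (hk : k ≤ n - 1) (hik : ¬ (k : ℤ) ≡ -(i : ℤ) [ZMOD n]) (s : ℕ) (hs₁ : 1 ≤ s)
    (hsn : s ≤ n - 1) (hs : (s : ℤ) ≡ -((i : ℤ) + k) [ZMOD n]) (γ : ℕ → 𝕜) (hγs : γ s = 1)
    (hγ : ∀ l : ℕ, 1 ≤ l → l < s →
      γ l = TaftDouble.qInt q (l + 1) ^ 2 * q ^ (-1 - (l : ℤ) + s) /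
        (TaftDouble.qInt q l * TaftDouble.qInt q (s - l) * (q - 1)) * γ (l + 1))
    (y : ℕ → TaftDouble.Dn n q)
    (hy : ∀ l : ℕ, y l = TaftDouble.Dn.b n q ^ i * TaftDouble.Dn.c n q ^ k *
      TaftDouble.Dn.d n q ^ l * TaftDouble.Dn.a n q ^ l)
    (w : Fin n × ZMod n → 𝕜)
    (hw : w = ∑ l ∈ Finset.Icc 1 s, γ l • TaftDouble.Tr n q (y l)) :
    ∃ μ : 𝕜,
      (TaftDouble.M n q (by omega)).HasEigenvector μ
        (TaftDouble.Tr n q (TaftDouble.Dn.b n q ^ i * TaftDouble.Dn.c n q ^ k)) ∧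
      w ∈ (TaftDouble.M n q (by omega)).maxGenEigenspace μ ∧
      (TaftDouble.M n q (by omega)).HasEigenvector μ
        (TaftDouble.M n q (by omega) w - μ • w) ∧
      w = TaftDouble.Tr n q (∑ l ∈ Finset.Icc 1 s, γ l • y l) ∧
      ¬ IsGroupLikeElem 𝕜 (∑ l ∈ Finset.Icc 1 s, γ l • y l) := by
  
  have hq : IsPrimitiveRoot q n := Fact.out
  have h0 : q ≠ 0 := hq.ne_zero (by omega)
  have h1 : q ≠ 1 := hq.ne_one (by omega)
  have hn2 : 2 ≤ n := by omega
  have hqs : q ^ s * (q ^ i * q ^ k) = 1 := by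
    rw [← pow_add, ← pow_add, hq.pow_eq_one_iff_dvd, ← Int.natCast_dvd_natCast]
    have := hs.symm.dvd
    push_cast
    rwa [sub_neg_eq_add] at this
  let μ : 𝕜 := (q ^ k)⁻¹ + q ^ i
  let A : ℕ → 𝕜 := fun l => (q ^ (k + l))⁻¹ + q ^ (i + l)
  let B : ℕ → 𝕜 := fun l => qInt q (l + 1) ^ 2 * ((q ^ (k + l))⁻¹ * (1 - q⁻¹))
  have hy0 : y 0 = Dn.b n q ^ i * Dn.c n q ^ k := by simp [hy]
  have hM0 : M n q hn2 (Tr n q (y 0)) = μ • Tr n q (y 0) := by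
    rw [hy0]
    exact M_Tr_zero hn2 i k
  have hM : ∀ l, M n q hn2 (Tr n q (y (l + 1))) =
      A (l + 1) • Tr n q (y (l + 1)) + B l • Tr n q (y l) := by
    intro l
    rw [hy, hy]
    exact M_Tr_succ hn2 i k l
  -- Since $q^{s+i+k}=1$, passing from index $0$ to index $s$ merely swaps the two summands $q^{-k}$
  -- and $q^i$.
  have hAs : A s = μ := by
    have e1 : (q ^ (k + s))⁻¹ = q ^ i := by
      refine (eq_inv_of_mul_eq_one_left ?_).symm
      rw [← hqs]
      ring
    have e2 : (q ^ k)⁻¹ = q ^ (i + s) := by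
      refine (eq_inv_of_mul_eq_one_left ?_).symm
      rw [← hqs]
      ring
    simp only [A, μ, e1, e2, add_comm]
  have hcancel : ∀ m, 1 ≤ m → m < s → γ m * (A m - μ) + γ (m + 1) * B m = 0 := fun m hm hms =>
    coefficient_cancel hq hm hms (by omega) hqs (hγ m hm hms)
  -- Partial sums telescope to a bottom and a top term. The top one is cancelled by the next
  -- summand, and for $m=s$ it vanishes because $A_s=\mu$.
  have hsum : ∀ m, 1 ≤ m → m ≤ s →
      ∑ l ∈ Finset.Icc 1 m, γ l • (M n q hn2 (Tr n q (y l)) - μ • Tr n q (y l)) =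
        (γ 1 * B 0) • Tr n q (y 0) + (γ m * (A m - μ)) • Tr n q (y m) := by
    intro m hm
    induction m, hm using Nat.le_induction with
    | base =>
      intro _
      rw [Finset.Icc_self, Finset.sum_singleton, hM]
      module
    | succ m hm ih =>
      intro hms
      rw [Finset.sum_Icc_succ_top (by omega), ih (by omega), hM,
        eq_neg_of_add_eq_zero_left (hcancel m hm (by omega))]
      module
  have hdiff : M n q hn2 w - μ • w = (γ 1 * B 0) • Tr n q (y 0) := by
    have := hsum s hs₁ le_rfl
    rw [hAs, sub_self, mul_zero, zero_smul, add_zero] at this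
    rw [← this, hw, map_sum, Finset.smul_sum, ← Finset.sum_sub_distrib]
    refine Finset.sum_congr rfl fun l _ => ?_
    rw [map_smul, smul_sub, smul_comm μ]
  -- As every $B_m$ with $1\le m<s$ is nonzero, a zero $\gamma_1$ would propagate upwards through
  -- the cancellation relations to $\gamma_s=1$.
  have hγ1 : γ 1 ≠ 0 := by
    intro h
    have : ∀ m, 1 ≤ m → m ≤ s → γ m = 0 := by
      intro m hm
      induction m, hm using Nat.le_induction with
      | base => exact fun _ => h
      | succ m hm ih =>
        intro hms
        have hc := hcancel m hm hms
        rw [ih (by omega), zero_mul, zero_add] at hc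
        refine (mul_eq_zero.1 hc).resolve_right (mul_ne_zero ?_ (mul_ne_zero ?_ ?_))
        · exact pow_ne_zero _ (qInt_ne_zero hq (by omega) (by omega))
        · exact inv_ne_zero (pow_ne_zero _ h0)
        · exact sub_ne_zero.2 fun e => h1 (inv_eq_one.1 e.symm)
    exact one_ne_zero (hγs.symm.trans (this s hs₁ le_rfl))
  have hB0 : B 0 ≠ 0 :=
    mul_ne_zero (pow_ne_zero _ (qInt_ne_zero hq (by omega) (by omega)))
      (mul_ne_zero (inv_ne_zero (pow_ne_zero _ h0))
        (sub_ne_zero.2 fun e => h1 (inv_eq_one.1 e.symm)))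
  have hT0 : Tr n q (y 0) ≠ 0 := by
    rw [hy0]
    exact Tr_b_pow_mul_c_pow_ne_zero i k
  refine ⟨μ, ?_, ?_, ?_, ?_, fun hG => ?_⟩
  · rw [← hy0, Module.End.hasEigenvector_iff, Module.End.mem_eigenspace_iff]
    exact ⟨hM0, hT0⟩
  · rw [Module.End.mem_maxGenEigenspace]
    -- One application of $M-\mu$ gives a multiple of the eigenvector $\mathrm{Tr}(y_0)$, and a
    -- second one kills it.
    refine ⟨2, ?_⟩
    have e : ∀ v, (M n q hn2 - μ • 1 : Module.End 𝕜 (Fin n × ZMod n → 𝕜)) v =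
        M n q hn2 v - μ • v := fun v => rfl
    rw [pow_two, Module.End.mul_apply, e w, hdiff, map_smul, e, hM0, sub_self, smul_zero]
  · rw [hdiff, Module.End.hasEigenvector_iff, Module.End.mem_eigenspace_iff, map_smul, hM0]
    exact ⟨smul_comm _ _ _, smul_ne_zero (mul_ne_zero hγ1 hB0) hT0⟩
  · rw [hw, ← TrLin_apply, map_sum]
    exact Finset.sum_congr rfl fun l _ => (map_smul (TrLin n q) _ _).symm
  · have hε := hG.counit_eq_one
    rw [map_sum, Finset.sum_eq_zero] at hε
    · exact zero_ne_one hε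
    · intro l hl
      rw [map_smul, hy, counit_b_c_d_a_eq_zero (by have := Finset.mem_Icc.1 hl; omega), smul_zero]
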